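/- **Setting.** Fix $n\ge 1$ and write $[n]=\{1,\dots,n\}$. Let $S_n$ be the symmetric group with simple transpositions $s_i=(i,i+1)$ and length function $\ell$ (minimal length of a word in the $s_i$), acting on $\mathbb Z^n$ by permuting coordinates. For $\lambda\in\mathbb Z_{\ge0}^n$ let $S_{n,\lambda}=\{w\in S_n: w\lambda=\lambda\}$. Let $\varpi_k=\varepsilon_1+\dots+\varepsilon_k$, where $\varepsilon_1,\dots,\varepsilon_n$ is the standard basis of $\mathbb Z^n$, and $(\mathbb Z_{\ge0}^n)_+=\{\lambda\in\mathbb Z_{\ge 0}^n:\lambda_1\ge\dots\ge\lambda_n\}$. Let $H$ be the affine Hecke algebra of type $GL_n$: the $\mathbb Z[t^{\pm1}]$-algebra generated by $T_1,\dots,T_{n-1}$, $X_1^{\pm1},\dots,X_n^{\pm1}$ with relations $T_i^2=(t-1)T_i+t$, $T_iT_{i+1}T_i=T_{i+1}T_iT_{i+1}$, $T_iT_j=T_jT_i$ for $|i-j|>1$, $X_iX_j=X_jX_i$, $T_iX_iT_i=tX_{i+1}$, and $T_iX_j=X_jT_i$ for $j\notin\{i,i+1\}$. Each $T_i$ is invertible,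 with $tT_i^{-1}=T_i+1-t$. For a reduced expression $w=s_{i_1}\cdots s_{i_k}$ put $T_w=T_{i_1}\cdots T_{i_k}$. Let $H_n$ be the span of all $T_w$, $w\in S_n$; for $\lambda\in\mathbb Z_{\ge0}^n$ let $H_{n,\lambda}$ be the span of the $T_w$ with $w\in S_{n,\lambda}$, and let $\mathbf 1_\lambda=\sum_{w\in S_{n,\lambda}}T_w$. A *column* of length $\ell\in[n]$ is a sequence $1\le i_1<\dots<i_\ell\le n$, identified with the subset $\{i_1,\dots,i_\ell\}$ of $[n]$; $B(\varpi_\ell)$ is the set of these. The group $S_n$ acts on $B(\varpi_\ell)$ by acting on entries. For a column $C$, let $u_C\in S_n$ be the permutation whose one-line notation lists $C$ in increasing order followed by $[n]\setminus C$ in increasing order. For $1\le\ell_1\le\dots\le\ell_r\le n$ and $C_i\in B(\varpi_{\ell_i})$, let $T=C_r\otimes\dots\otimes C_1$ be the filling of the Young diagram of $\lambda=\sum_i\varpi_{\ell_i}$ whose columns, from left to right, are $C_r,\dots,C_1$; it is *semistandard* if its rows weakly increase from left to right, and *highest weight* if $C_i=(1,\dots,\ell_i)$ for all $i$. For $\mu\in(\mathbb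 Z_{\ge0}^n)_+$ let $T^0_\mu$ be the highest weight tableau of shape $\mu$. If every column of $T$ is at least as long as every column of $T^0_\mu$, then $T\otimes T^0_\mu$ is the filling whose columns are those of $T$ followed by those of $T^0_\mu$. Define $\Psi_T\in H_n$ recursively. For a single column $C\in B(\varpi_\ell)$, $\Psi_C=t^{\ell(u_C)}(T_{u_C^{-1}})^{-1}\mathbf 1_{\varpi_\ell}$. If $T=C\otimes S$ with $C\in B(\varpi_\ell)$ and $S$ having at least one column, all of length at most $\ell$, write (uniquely) $\Psi_S=\sum_{E\in B(\varpi_\ell)}T_{u_E}h_{E,S}$ with $h_{E,S}\in H_{n,\varpi_\ell}$, and put $\Psi_T=t^{\ell(u_C)}(T_{u_C^{-1}})^{-1}h_{C,S}$. (For the filling with no columns, $\Psi_\emptyset=\mathbf 1_0=\sum_{w\in S_n}T_w$.) For a column $C$ and $j\in[n-1]$, let $\sigma^j_C=-1$ if $j\in C$ and $j+1\notin C$, and $\sigma^j_C=+1$ otherwise. For $k\in[r]$ let $$\Omega^j_k(C_r\otimes\dots\otimes C_1)=C_r\otimes\dots\otimes C_{k+1}\otimes s_jC_k\otimes\dots\otimes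 s_jC_1 .$$ **Theorem.** Let $T=C_r\otimes\dots\otimes C_1$ with $C_i\in B(\varpi_{\ell_i})$ and $1\le\ell_1\le\dots\le\ell_r\le n$. (a) If $T$ is not semistandard, then $\Psi_T=0$. (b) If $T$ is highest weight, of shape $\lambda=\sum_{i=1}^r\varpi_{\ell_i}$, then $\Psi_T=\mathbf 1_\lambda$. (c) Let $r\ge1$ and let $\mu\in(\mathbb Z_{\ge0}^n)_+$ be such that every column of $T$ is at least as long as every column of $T^0_\mu$ and $T\otimes T^0_\mu$ is semistandard. If $j\in[n-1]$ satisfies $j\notin C_1$ and $j+1\in C_1$, then $$\Psi_{T\otimes T^0_\mu}=A+\sum_{\substack{1\le k<r\\ \sigma^j_{C_k}\sigma^j_{C_{k+1}}=-1}}\sigma^j_{C_k}(1-t)\,\Psi_{\Omega^j_k(T)\otimes T^0_\mu},$$ where $$A=\begin{cases}T_j\,\Psi_{\Omega^j_r(T)\otimes T^0_\mu}&\text{if } j\in C_r,\ j+1\notin C_r,\\ tT_j^{-1}\,\Psi_{\Omega^j_r(T)\otimes T^0_\mu}&\text{otherwise.}\end{cases}$$ -/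

import Mathlib

/-!
Throughout, the rank is `n = m + 1`, so that `n ≥ 1`.  The set `[n]` is `Fin (m + 1)`, and the index
`j ∈ [n - 1]` is an element of `Fin m`, the pair `(j, j + 1)` being `(j.castSucc, j.succ)`.
-/

namespace HeckeLift

open scoped BigOperators

noncomputable section

/-- The coefficient ring `ℤ[t, t⁻¹]`. -/
abbrev R : Type := LaurentPolynomial ℤ

/-- The variable `t`. -/
def t : R := LaurentPolynomial.T 1

/-- The variable `t⁻¹`. -/
def tInv : R := LaurentPolynomial.T (-1)

theorem t_mul_tInv : t * tInv = 1 := by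
  rw [t, tInv, ← LaurentPolynomial.T_add, add_neg_cancel, LaurentPolynomial.T_zero]

theorem tInv_mul_t : tInv * t = 1 := by
  rw [mul_comm, t_mul_tInv]

/-! ### The symmetric group -/

/-- The simple transposition `s_i = (i, i + 1)`. -/
def s {m : ℕ} (i : Fin m) : Equiv.Perm (Fin (m + 1)) := Equiv.swap i.castSucc i.succ

/-- `L = (i_1, …, i_ℓ)` is a reduced expression of `w`: `w = s_{i_1} ⋯ s_{i_ℓ}` and no shorter word
represents `w`. -/
def IsReducedWord {m : ℕ} (w : Equiv.Perm (Fin (m + 1))) (L : List (Fin m)) : Prop :=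
  (L.map s).prod = w ∧ ∀ L' : List (Fin m), (L'.map s).prod = w → L.length ≤ L'.length

theorem exists_word {m : ℕ} (w : Equiv.Perm (Fin (m + 1))) :
    ∃ L : List (Fin m), (L.map s).prod = w := by
  have hw : w ∈ Submonoid.closure
      (Set.range fun i : Fin m => Equiv.swap i.castSucc i.succ) := by
    rw [Equiv.Perm.mclosure_swap_castSucc_succ]; trivial
  induction hw using Submonoid.closure_induction with
  | mem x hx => obtain ⟨i, rfl⟩ := hx; exact ⟨[i], by simp [s]⟩
  | one => exact ⟨[], rfl⟩
  | mul x y _ _ hx hy =>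
    obtain ⟨L, rfl⟩ := hx
    obtain ⟨M, rfl⟩ := hy
    exact ⟨L ++ M, by simp⟩

theorem exists_reducedWord {m : ℕ} (w : Equiv.Perm (Fin (m + 1))) :
    ∃ L : List (Fin m), IsReducedWord w L := by
  classical
  have hex : ∃ k : ℕ, ∃ L : List (Fin m), (L.map s).prod = w ∧ L.length = k := by
    obtain ⟨L, hL⟩ := exists_word w
    exact ⟨_, L, hL, rfl⟩
  obtain ⟨L, hL, hk⟩ := Nat.find_spec hex
  exact ⟨L, hL, fun L' hL' => hk ▸ Nat.find_min' hex ⟨L', hL', rfl⟩⟩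

/-- A chosen reduced expression of `w`. -/
def reducedWord {m : ℕ} (w : Equiv.Perm (Fin (m + 1))) : List (Fin m) :=
  (exists_reducedWord w).choose

/-- The length `ℓ(w)`. -/
def len {m : ℕ} (w : Equiv.Perm (Fin (m + 1))) : ℕ := (reducedWord w).length

/-- The stabilizer `S_{n,λ} = {w | w λ = λ}`, where `(w λ)_i = λ_{w⁻¹ i}` (that is,
`w ε_k = ε_{w k}`). -/
def stab {m : ℕ} (lam : Fin (m + 1) → ℕ) : Finset (Equiv.Perm (Fin (m + 1))) :=
  Finset.univ.filter fun w => (fun i => lam (w⁻¹ i)) = lam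

/-- `ϖ_k = ε_1 + ⋯ + ε_k`. -/
def varpi (m k : ℕ) : Fin (m + 1) → ℕ := fun i => if (i : ℕ) < k then 1 else 0

/-! ### The affine Hecke algebra of type `GL_n` -/

/-- Generators `T_1, …, T_{n-1}`, `X_1^{±1}, …, X_n^{±1}`. -/
inductive Gen (m : ℕ) : Type
  | T (i : Fin m) : Gen m
  | X (k : Fin (m + 1)) : Gen m
  | Xinv (k : Fin (m + 1)) : Gen m

/-- The generator `T_i` in the free algebra. -/
def fT {m : ℕ} (i : Fin m) : FreeAlgebra R (Gen m) := FreeAlgebra.ι R (Gen.T i)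

/-- The generator `X_k` in the free algebra. -/
def fX {m : ℕ} (k : Fin (m + 1)) : FreeAlgebra R (Gen m) := FreeAlgebra.ι R (Gen.X k)

/-- The generator `X_k⁻¹` in the free algebra. -/
def fXinv {m : ℕ} (k : Fin (m + 1)) : FreeAlgebra R (Gen m) := FreeAlgebra.ι R (Gen.Xinv k)

/-- The defining relations of the affine Hecke algebra. -/
inductive Rel (m : ℕ) : FreeAlgebra R (Gen m) → FreeAlgebra R (Gen m) → Prop
  | quad (i : Fin m) : Rel m (fT i * fT i) ((t - 1) • fT i + t • 1)
  | braid (i j : Fin m) (h : (i : ℕ) + 1 = j) :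
      Rel m (fT i * fT j * fT i) (fT j * fT i * fT j)
  | far (i j : Fin m) (h : (i : ℕ) + 1 < j ∨ (j : ℕ) + 1 < i) :
      Rel m (fT i * fT j) (fT j * fT i)
  | X_mul_Xinv (k : Fin (m + 1)) : Rel m (fX k * fXinv k) 1
  | Xinv_mul_X (k : Fin (m + 1)) : Rel m (fXinv k * fX k) 1
  | X_comm (k l : Fin (m + 1)) : Rel m (fX k * fX l) (fX l * fX k)
  | TXT (i : Fin m) : Rel m (fT i * fX i.castSucc * fT i) (t • fX i.succ)
  | TX_comm (i : Fin m) (k : Fin (m + 1)) (h₁ : k ≠ i.castSucc) (h₂ : k ≠ i.succ) :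
      Rel m (fT i * fX k) (fX k * fT i)

/-- The affine Hecke algebra `H` of type `GL_n`, `n = m + 1`, over `ℤ[t, t⁻¹]`. -/
abbrev H (m : ℕ) : Type := RingQuot (Rel m)

/-- The generator `T_i` of `H`. -/
def T {m : ℕ} (i : Fin m) : H m := RingQuot.mkAlgHom R (Rel m) (fT i)

theorem T_mul_T {m : ℕ} (i : Fin m) : T i * T i = (t - 1) • T i + t • (1 : H m) := by
  have h := RingQuot.mkAlgHom_rel R (Rel.quad i)
  simpa only [map_mul, map_add, map_smul, map_one, T] using h

/-- `T_i` as an invertible element of `H`, with `t T_i⁻¹ = T_i + 1 - t`. -/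
def TUnit {m : ℕ} (i : Fin m) : (H m)ˣ where
  val := T i
  inv := tInv • (T i + (1 - t) • 1)
  val_inv := by
    rw [mul_smul_comm, mul_add, T_mul_T, mul_smul_comm, mul_one,
      show (t - 1) • T i + t • (1 : H m) + (1 - t) • T i = t • 1 by module, smul_smul,
      tInv_mul_t, one_smul]
  inv_val := by
    rw [smul_mul_assoc, add_mul, T_mul_T, smul_mul_assoc, one_mul,
      show (t - 1) • T i + t • (1 : H m) + (1 - t) • T i = t • 1 by module, smul_smul,
      tInv_mul_t, one_smul]

/-- `T_w = T_{i_1} ⋯ T_{i_ℓ}` for a reduced expression `w = s_{i_1} ⋯ s_{i_ℓ}`, as an invertible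
element of `H`. -/
def Tw {m : ℕ} (w : Equiv.Perm (Fin (m + 1))) : (H m)ˣ := ((reducedWord w).map TUnit).prod

/-- `𝟏_λ = ∑_{w ∈ S_{n,λ}} T_w`. -/
def oneElt {m : ℕ} (lam : Fin (m + 1) → ℕ) : H m := ∑ w ∈ stab lam, (Tw w : H m)

/-- The parabolic subalgebra `H_{n,λ}`, the span of the `T_w` with `w ∈ S_{n,λ}`. -/
def parabolic {m : ℕ} (lam : Fin (m + 1) → ℕ) : Submodule R (H m) :=
  Submodule.span R ((fun w => (Tw w : H m)) '' (stab lam : Set (Equiv.Perm (Fin (m + 1)))))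

/-! ### Columns -/

/-- A column `(i_1 < ⋯ < i_ℓ)` with entries in `[n]`, identified with the set of its entries; its
length is the cardinality.  (Being non-empty is required in `IsTensor` below.) -/
abbrev Column (m : ℕ) : Type := Finset (Fin (m + 1))

/-- The permutation `u_I`, whose one-line notation is `I` in increasing order followed by `[n] - I`
in increasing order. -/
def u {m : ℕ} (I : Column m) : Equiv.Perm (Fin (m + 1)) :=
  (finCongr (show m + 1 = I.card + Iᶜ.card by
      rw [Finset.card_add_card_compl, Fintype.card_fin])).trans
    (finSumFinEquiv.symm.trans (finSumEquivOfFinset rfl rfl))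

/-- `s_j C`: apply `s_j` to all the entries of `C`. -/
def sAct {m : ℕ} (j : Fin m) (C : Column m) : Column m := C.map (s j).toEmbedding

/-- The sign `σ^j_C`. -/
def sgn {m : ℕ} (j : Fin m) (C : Column m) : ℤ :=
  if j.castSucc ∈ C ∧ j.succ ∉ C then -1 else 1

/-- The column `C` is `(1, …, ℓ)`. -/
def IsHighestColumn {m : ℕ} (C : Column m) : Prop :=
  C = Finset.univ.filter fun i : Fin (m + 1) => (i : ℕ) < C.card

/-! ### Column-strict fillings

A column-strict filling `C_r ⊗ ⋯ ⊗ C_1` is the list `[C_r, …, C_1]` of its columns from left to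
right, so that `⊗` is concatenation of lists. -/

/-- `L = [C_r, …, C_1]` is an element of `B(ϖ_{ℓ_r}) ⊗ ⋯ ⊗ B(ϖ_{ℓ_1})` for some
`1 ≤ ℓ_1 ≤ ⋯ ≤ ℓ_r ≤ n`. -/
def IsTensor {m : ℕ} (L : List (Column m)) : Prop :=
  (∀ C ∈ L, C.Nonempty) ∧ L.Pairwise fun F E => E.card ≤ F.card

/-- The rows increase weakly from left to right.  (Columns increase strictly by construction.) -/
def IsSemistandard {m : ℕ} (L : List (Column m)) : Prop :=
  L.Pairwise fun F E => ∀ (i : ℕ) (hF : i < F.card) (hE : i < E.card),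
    F.orderEmbOfFin rfl ⟨i, hF⟩ ≤ E.orderEmbOfFin rfl ⟨i, hE⟩

/-- All columns are highest weight. -/
def IsHighestWeight {m : ℕ} (L : List (Column m)) : Prop := ∀ C ∈ L, IsHighestColumn C

/-- The shape `ϖ_{ℓ_r} + ⋯ + ϖ_{ℓ_1}`. -/
def shape {m : ℕ} (L : List (Column m)) : Fin (m + 1) → ℕ :=
  (L.map fun C => varpi m C.card).sum

/-- The tableau `T^0_μ` of shape `μ`, all of whose entries in row `i` are `i`: its `c`-th column
consists of the `i` such that the `i`-th row of `μ` reaches column `c`. -/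
def highestTableau {m : ℕ} (μ : Fin (m + 1) → ℕ) : List (Column m) :=
  (List.range (μ 0)).map fun c => Finset.univ.filter fun i => c < μ i

/-- `C_r ⊗ ⋯ ⊗ C_1` for columns `C_1, C_2, …` -/
def tensor {m : ℕ} (C : ℕ → Column m) : ℕ → List (Column m)
  | 0 => []
  | r + 1 => C (r + 1) :: tensor C r

/-- `Ω^j_k` on the sequence of columns: `C_1, …, C_k` are replaced by `s_j C_1, …, s_j C_k`. -/
def Omega {m : ℕ} (j : Fin m) (k : ℕ) (C : ℕ → Column m) : ℕ → Column m :=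
  fun i => if i ≤ k then sAct j (C i) else C i

/-! ### The elements `Ψ_T` -/

/-- `h` is the family of coefficients in the decomposition `x = ∑_E T_{u_E} h_E`, where `E` runs over
the columns of length `l` and `h_E ∈ H_{n,ϖ_l}`. -/
def IsDecomp {m : ℕ} (l : ℕ) (x : H m) (h : Column m → H m) : Prop :=
  (∀ E, h E ∈ parabolic (varpi m l)) ∧
    x = ∑ E ∈ Finset.powersetCard l Finset.univ, (Tw (u E) : H m) * h E

open Classical in
/-- The coefficient `h_C` in the decomposition `x = ∑_E T_{u_E} h_E`, `E` running over the columns of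
the same length as `C`.  (For `x` in the span of the `T_w` the decomposition exists, and each of its
coefficients is unique.) -/
def coeff {m : ℕ} (C : Column m) (x : H m) : H m :=
  if hx : ∃ h, IsDecomp C.card x h then hx.choose C else 0

/-- `t^{ℓ(u_C)} (T_{u_C⁻¹})⁻¹`. -/
def lead {m : ℕ} (C : Column m) : H m :=
  t ^ len (u C) • (((Tw (u C)⁻¹)⁻¹ : (H m)ˣ) : H m)

/-- The element `Ψ_T`: for one column `Ψ_C = t^{ℓ(u_C)} (T_{u_C⁻¹})⁻¹ 𝟏_{ϖ_ℓ}`, and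
`Ψ_{C ⊗ S} = t^{ℓ(u_C)} (T_{u_C⁻¹})⁻¹ h_{C,S}` where `Ψ_S = ∑_E T_{u_E} h_{E,S}`.
The empty filling gets the value `𝟏_0`. -/
def Psi {m : ℕ} : List (Column m) → H m
  | [] => oneElt 0
  | [C] => lead C * oneElt (varpi m C.card)
  | C :: D :: S => lead C * coeff C (Psi (D :: S))

end

end HeckeLift

open HeckeLift

namespace HeckeLift

noncomputable section

/-! ### Inversions and length -/

variable {m : ℕ}

/-! Everything takes place in the finite Hecke algebra `H_n`, which is `parabolic 0`. There,
tensoring with `C` on the left is a linear map `addColumn C`: extract the coefficient `comp C` at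
the coset of `u C`, then multiply by `lead C`. By `Psi_cons` this also covers the passage from the
empty filling to one column, so each part is an induction on the number of columns.

The decomposition `x = ∑ T_{u_E} h_E` makes sense once `T_w` is independent of the reduced word
(Matsumoto's theorem) and the `T_w` are linearly independent in the affine algebra. For the latter,
the regular representation of `H_n` extends to `H`, the `X_k` acting by Jucys–Murphy elements, and
applying `T_w` to the basis vector of `1` gives that of `w`.

(a) `lead C * h` is a combination of `T_w` for which the column `w {1, …, l}` is at most `C`
entrywise (`lead_mul_mem_below`). If `D` is no longer than `C`, then `comp C` kills the span
attached to `D` unless each row of `C ⊗ D` increases weakly (`comp_eq_zero`,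
`orderEmbOfFin_le_of_cnt_le`).

(b) A highest weight column has `u C = 1` and `lead C = 1`, and the stabilizer of a sum of dominant
weights is the intersection of the stabilizers (`comp_oneElt`).

(c) `T_j` passes through `addColumn E` by one of three rules, according to which of `j`, `j + 1` lie
in `E` (the `addColumn_T_mul_of_*` lemmas). Semistandardness gives `μ_j = μ_{j+1}`, so `T_j`, and
hence `t T_j⁻¹`, acts on the element of `T^0_μ` by a scalar: `t` and `1` respectively. Inserting `t
T_j⁻¹` and moving it left through the columns, one switches between `T_j` and `t T_j⁻¹ = T_j + 1 -
t` exactly where the sign changes; each switch costs one term `± (1 - t) Ψ` (`Psi_exchange`). -/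

@[simp] theorem s_castSucc (i : Fin m) : s i i.castSucc = i.succ := Equiv.swap_apply_left _ _

@[simp] theorem s_succ (i : Fin m) : s i i.succ = i.castSucc := Equiv.swap_apply_right _ _

theorem s_of_ne (i : Fin m) {a : Fin (m + 1)} (h₁ : a ≠ i.castSucc) (h₂ : a ≠ i.succ) :
    s i a = a := Equiv.swap_apply_of_ne_of_ne h₁ h₂

@[simp] theorem s_mul_self (i : Fin m) : s i * s i = 1 := Equiv.swap_mul_self _ _

@[simp] theorem s_inv (i : Fin m) : (s i)⁻¹ = s i := Equiv.swap_inv _ _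

@[simp] theorem s_s (i : Fin m) (a : Fin (m + 1)) : s i (s i a) = a :=
  Equiv.swap_apply_self _ _ _

@[simp] theorem s_mul_s_mul (i : Fin m) (w : Equiv.Perm (Fin (m + 1))) : s i * (s i * w) = w := by
  rw [← mul_assoc, s_mul_self, one_mul]

theorem s_mul_inv_apply (i : Fin m) (w : Equiv.Perm (Fin (m + 1))) (a : Fin (m + 1)) :
    (s i * w)⁻¹ a = w⁻¹ (s i a) := by
  rw [mul_inv_rev, s_inv, Equiv.Perm.mul_apply]

theorem s_lt_s (i : Fin m) {a b : Fin (m + 1)} (h : a < b)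
    (hab : ¬ (a = i.castSucc ∧ b = i.succ)) : s i a < s i b := by
  unfold s
  rw [Equiv.swap_apply_def, Equiv.swap_apply_def]
  rw [Fin.lt_def] at h ⊢
  simp only [Fin.ext_iff, Fin.val_castSucc, Fin.val_succ] at *
  split_ifs <;> (try simp only [Fin.val_castSucc, Fin.val_succ]) <;> omega

/-- The pairs of values that occur in the wrong order in the one-line notation of `w`. -/
def inversions (w : Equiv.Perm (Fin (m + 1))) : Finset (Fin (m + 1) × Fin (m + 1)) :=
  Finset.univ.filter fun p => p.1 < p.2 ∧ w⁻¹ p.2 < w⁻¹ p.1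

/-- Inversions are pairs of values, so left multiplication by `s i` transports them along `s i × s
i`. Only the pair `(i, i + 1)` has its order reversed by `s i`, and it becomes the one new
inversion. -/
theorem card_inversions_s_mul {i : Fin m} {w : Equiv.Perm (Fin (m + 1))}
    (h : w⁻¹ i.castSucc < w⁻¹ i.succ) :
    (inversions (s i * w)).card = (inversions w).card + 1 := by
  have key : inversions (s i * w) = insert (i.castSucc, i.succ)
      ((inversions w).map ((s i).prodCongr (s i)).toEmbedding) := by
    ext ⟨a, b⟩
    simp only [inversions, Finset.mem_filter, Finset.mem_univ, true_and, Finset.mem_insert,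
      Prod.mk.injEq, Finset.mem_map_equiv, Equiv.prodCongr_symm, Equiv.prodCongr_apply,
      Prod.map_apply, s_mul_inv_apply]
    have e : (s i).symm = s i := s_inv i
    rw [e]
    constructor
    · rintro ⟨hab, hw⟩
      by_cases hc : a = i.castSucc ∧ b = i.succ
      · exact Or.inl hc
      · exact Or.inr ⟨s_lt_s i hab hc, hw⟩
    · rintro (⟨rfl, rfl⟩ | ⟨hab, hw⟩)
      · simpa using h
      · refine ⟨?_, hw⟩
        have := s_lt_s i hab (fun hc => by
          rw [hc.1, hc.2] at hw
          exact absurd hw h.not_gt)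
        simpa using this
  rw [key, Finset.card_insert_of_notMem, Finset.card_map]
  simp only [Finset.mem_map_equiv, Equiv.prodCongr_symm, Equiv.prodCongr_apply, Prod.map_apply]
  have e : (s i).symm = s i := s_inv i
  simp [e, inversions, Fin.le_of_lt]

theorem card_inversions_s_mul_of_gt {i : Fin m} {w : Equiv.Perm (Fin (m + 1))}
    (h : w⁻¹ i.succ < w⁻¹ i.castSucc) :
    (inversions (s i * w)).card + 1 = (inversions w).card := by
  have := card_inversions_s_mul (i := i) (w := s i * w) (by simpa [s_mul_inv_apply] using h)
  rw [s_mul_s_mul] at this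
  exact this.symm

theorem inv_castSucc_ne_inv_succ (i : Fin m) (w : Equiv.Perm (Fin (m + 1))) :
    w⁻¹ i.castSucc ≠ w⁻¹ i.succ := fun h =>
  (Fin.castSucc_lt_succ (i := i)).ne (w⁻¹.injective h)

theorem card_inversions_le (L : List (Fin m)) :
    (inversions (L.map s).prod).card ≤ L.length := by
  induction L with
  | nil =>
    rw [List.map_nil, List.prod_nil, List.length_nil, Nat.le_zero, Finset.card_eq_zero]
    exact Finset.filter_eq_empty_iff.2 fun p _ h => absurd h.1 h.2.not_gt
  | cons i L ih =>
    rw [List.map_cons, List.prod_cons, List.length_cons]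
    rcases lt_or_gt_of_ne (inv_castSucc_ne_inv_succ i (L.map s).prod) with h | h
    · rw [card_inversions_s_mul h]; omega
    · have := card_inversions_s_mul_of_gt h; omega

theorem eq_one_of_strictMono {w : Equiv.Perm (Fin (m + 1))} (hw : StrictMono w) : w = 1 := by
  ext a
  have := congrArg (fun e : Fin (m + 1) ≃o Fin (m + 1) => e a) (Subsingleton.elim
    (hw.orderIsoOfSurjective _ w.surjective) (OrderIso.refl _))
  simpa using congrArg Fin.val this

theorem exists_descent {w : Equiv.Perm (Fin (m + 1))} (hw : w ≠ 1) :
    ∃ i : Fin m, w⁻¹ i.succ < w⁻¹ i.castSucc := by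
  by_contra! h
  have hmono : StrictMono (w⁻¹ : Equiv.Perm (Fin (m + 1))) := Fin.strictMono_iff_lt_succ.2 fun i =>
    lt_of_le_of_ne (h i) (inv_castSucc_ne_inv_succ i w)
  apply hw
  rw [← inv_eq_one]
  exact eq_one_of_strictMono hmono

theorem exists_word_card_inversions (w : Equiv.Perm (Fin (m + 1))) :
    ∃ L : List (Fin m), (L.map s).prod = w ∧ L.length = (inversions w).card := by
  induction hk : (inversions w).card generalizing w with
  | zero =>
    refine ⟨[], ?_, rfl⟩
    by_contra hw
    obtain ⟨i, hi⟩ := exists_descent (w := w) (fun h => hw (by simp [h]))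
    have := card_inversions_s_mul_of_gt hi
    omega
  | succ k ih =>
    have hw : w ≠ 1 := by
      rintro rfl
      have := card_inversions_le (m := m) []
      simp only [List.map_nil, List.prod_nil, List.length_nil] at this
      omega
    obtain ⟨i, hi⟩ := exists_descent hw
    have h1 := card_inversions_s_mul_of_gt hi
    obtain ⟨L, hL, hlen⟩ := ih (s i * w) (by omega)
    exact ⟨i :: L, by simp [hL], by simp [hlen]⟩

theorem IsReducedWord.length_eq {w : Equiv.Perm (Fin (m + 1))} {L : List (Fin m)}
    (h : IsReducedWord w L) : L.length = (inversions w).card := by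
  obtain ⟨M, hM, hlen⟩ := exists_word_card_inversions w
  refine le_antisymm (hlen ▸ h.2 M hM) ?_
  have := card_inversions_le L
  rwa [h.1] at this

theorem isReducedWord_iff {w : Equiv.Perm (Fin (m + 1))} {L : List (Fin m)} :
    IsReducedWord w L ↔ (L.map s).prod = w ∧ L.length = (inversions w).card := by
  refine ⟨fun h => ⟨h.1, h.length_eq⟩, fun h => ⟨h.1, fun L' hL' => ?_⟩⟩
  rw [h.2, ← hL']
  exact card_inversions_le L'

theorem reducedWord_spec (w : Equiv.Perm (Fin (m + 1))) : IsReducedWord w (reducedWord w) :=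
  (exists_reducedWord w).choose_spec

theorem len_eq_card_inversions (w : Equiv.Perm (Fin (m + 1))) :
    len w = (inversions w).card := (reducedWord_spec w).length_eq

theorem len_s_mul {i : Fin m} {w : Equiv.Perm (Fin (m + 1))}
    (h : w⁻¹ i.castSucc < w⁻¹ i.succ) : len (s i * w) = len w + 1 := by
  rw [len_eq_card_inversions, len_eq_card_inversions, card_inversions_s_mul h]

theorem IsReducedWord.cons {i : Fin m} {w : Equiv.Perm (Fin (m + 1))} {L : List (Fin m)}
    (hL : IsReducedWord w L) (h : w⁻¹ i.castSucc < w⁻¹ i.succ) :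
    IsReducedWord (s i * w) (i :: L) := by
  rw [isReducedWord_iff] at *
  refine ⟨by simp [hL.1], ?_⟩
  rw [card_inversions_s_mul h, List.length_cons, hL.2]

theorem IsReducedWord.of_cons {i : Fin m} {w : Equiv.Perm (Fin (m + 1))} {L : List (Fin m)}
    (hL : IsReducedWord w (i :: L)) :
    w⁻¹ i.succ < w⁻¹ i.castSucc ∧ IsReducedWord (s i * w) L := by
  rw [isReducedWord_iff] at *
  have hw : (L.map s).prod = s i * w := by rw [← hL.1]; simp
  have h1 := card_inversions_le L
  rw [hw] at h1
  have h2 := hL.2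
  rw [List.length_cons] at h2
  rcases lt_or_gt_of_ne (inv_castSucc_ne_inv_succ i w) with h | h
  · have := card_inversions_s_mul h
    omega
  · have := card_inversions_s_mul_of_gt h
    exact ⟨h, hw, by omega⟩

theorem IsReducedWord.reverse {w : Equiv.Perm (Fin (m + 1))} {L : List (Fin m)}
    (hL : IsReducedWord w L) : IsReducedWord w⁻¹ L.reverse := by
  have key : ∀ (M : List (Fin m)), (M.reverse.map s).prod = (M.map s).prod⁻¹ := fun M => by
    rw [List.prod_inv_reverse, List.map_reverse, List.map_map]
    congr 2
  refine ⟨by rw [key, hL.1], fun L' hL' => ?_⟩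
  have := hL.2 L'.reverse (by rw [key, hL', inv_inv])
  simpa using this

/-! ### Matsumoto's theorem -/

theorem s_mul_s_mul_of_far {i j : Fin m} (h : (i : ℕ) + 1 < j) (w : Equiv.Perm (Fin (m + 1))) :
    s j * (s i * w) = s i * (s j * w) := by
  have d1 : j.castSucc ≠ i.castSucc := by simp [Fin.ext_iff]; omega
  have d2 : j.castSucc ≠ i.succ := by simp [Fin.ext_iff]; omega
  have d3 : j.succ ≠ i.castSucc := by simp [Fin.ext_iff]; omega
  have d4 : j.succ ≠ i.succ := by simp [Fin.ext_iff]; omega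
  rw [← mul_assoc, ← mul_assoc]
  congr 1
  exact (Equiv.Perm.Disjoint.commute (by
    intro a
    by_cases h1 : a = i.castSucc
    · subst h1; exact Or.inl (s_of_ne j d1.symm d3.symm)
    · by_cases h2 : a = i.succ
      · subst h2; exact Or.inl (s_of_ne j d2.symm d4.symm)
      · exact Or.inr (s_of_ne i h1 h2)))

theorem s_mul_s_mul_s_mul_of_adj {i j : Fin m} (h : (i : ℕ) + 1 = j)
    (w : Equiv.Perm (Fin (m + 1))) : s i * (s j * (s i * w)) = s j * (s i * (s j * w)) := by
  have a1 : j.castSucc = i.succ := by simp [Fin.ext_iff]; omega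
  have a2 : i.castSucc ≠ j.succ := by simp [Fin.ext_iff]; omega
  have a3 : i.castSucc ≠ i.succ := by simp [Fin.ext_iff]
  have a4 : i.succ ≠ j.succ := by simp [Fin.ext_iff]; omega
  have b1 : s j i.castSucc = i.castSucc := s_of_ne j (a1 ▸ a3) a2
  have b2 : s i j.succ = j.succ := s_of_ne i a2.symm a4.symm
  have b3 : s j i.succ = j.succ := by rw [← a1, s_castSucc]
  have b4 : s j j.succ = i.succ := by rw [← a1, s_succ]
  simp only [← mul_assoc]
  congr 1
  ext1 a
  simp only [Equiv.Perm.mul_apply]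
  by_cases h1 : a = i.castSucc
  · subst h1; simp only [s_castSucc, b1, b2, b3]
  · by_cases h2 : a = i.succ
    · subst h2; simp only [s_succ, s_castSucc, b1, b2, b3]; exact a1.symm
    · by_cases h3 : a = j.succ
      · subst h3; simp only [s_succ, b1, b2, b4]
      · rw [s_of_ne i h1 h2, s_of_ne j (a1 ▸ h2) h3, s_of_ne i h1 h2,
          s_of_ne j (a1 ▸ h2) h3]

/-- Matsumoto's theorem, by induction on length. Two words with the same first letter are compared
after deleting it. If the first letters `i` and `j` differ, both are left descents of `w`, so `w`
also has reduced words starting with the two expressions of the longest element of `⟨s i, s j⟩`;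
these differ by one far or braid relation. -/
theorem IsReducedWord.prod_map_eq {G : Type*} [Monoid G] {τ : Fin m → G}
    (hbraid : ∀ i j : Fin m, (i : ℕ) + 1 = j → τ i * τ j * τ i = τ j * τ i * τ j)
    (hfar : ∀ i j : Fin m, (i : ℕ) + 1 < j → τ i * τ j = τ j * τ i)
    {w : Equiv.Perm (Fin (m + 1))} {L L' : List (Fin m)}
    (hL : IsReducedWord w L) (hL' : IsReducedWord w L') :
    (L.map τ).prod = (L'.map τ).prod := by
  induction hN : L.length using Nat.strong_induction_on generalizing w L L' with
  | _ N ih =>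
  subst hN
  have main : ∀ (i j : Fin m) (M M' : List (Fin m)), i < j → IsReducedWord w (i :: M) →
      IsReducedWord w (j :: M') → M.length < L.length → M'.length < L.length →
      τ i * (M.map τ).prod = τ j * (M'.map τ).prod := by
    intro i j M M' hij hM hM' hlt hlt'
    obtain ⟨hi, hMr⟩ := hM.of_cons
    obtain ⟨hj, hMr'⟩ := hM'.of_cons
    rcases Nat.lt_or_ge ((i : ℕ) + 1) j with hf | hn
    · have d1 : j.castSucc ≠ i.castSucc := by simp [Fin.ext_iff]; omega
      have d2 : j.castSucc ≠ i.succ := by simp [Fin.ext_iff]; omega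
      have d3 : j.succ ≠ i.castSucc := by simp [Fin.ext_iff]; omega
      have d4 : j.succ ≠ i.succ := by simp [Fin.ext_iff]; omega
      have hcomm := s_mul_s_mul_of_far hf w
      -- Here `w'` is `w` with the prefix `s i * s j` removed; prepending `j` or `i` to a reduced
      -- word of `w'` gives words to which the induction hypothesis applies.
      obtain ⟨w', hw'⟩ : ∃ w', w' = s j * (s i * w) := ⟨_, rfl⟩
      have hK := reducedWord_spec w'
      have e1 : IsReducedWord (s i * w) (j :: reducedWord w') := by
        have := hK.cons (i := j) (by
          rw [hw']
          simp only [s_mul_inv_apply, s_castSucc, s_succ, s_of_ne i d1 d2, s_of_ne i d3 d4]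
          exact hj)
        rwa [hw', s_mul_s_mul, ← hw'] at this
      have e2 : IsReducedWord (s j * w) (i :: reducedWord w') := by
        have := hK.cons (i := i) (by
          rw [hw', hcomm]
          simp only [s_mul_inv_apply, s_castSucc, s_succ, s_of_ne j d1.symm d3.symm,
            s_of_ne j d2.symm d4.symm]
          exact hi)
        rwa [hw', hcomm, s_mul_s_mul, ← hcomm, ← hw'] at this
      rw [ih _ hlt hMr e1 rfl, ih _ hlt' hMr' e2 rfl, List.map_cons, List.map_cons, List.prod_cons,
        List.prod_cons, ← mul_assoc, ← mul_assoc, hfar i j hf]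
    · have hn' : (i : ℕ) + 1 = j := by have := Fin.lt_def.1 hij; omega
      have a1 : j.castSucc = i.succ := by simp [Fin.ext_iff]; omega
      have a2 : i.castSucc ≠ j.succ := by simp [Fin.ext_iff]; omega
      have a3 : i.castSucc ≠ i.succ := by simp [Fin.ext_iff]
      have a4 : i.succ ≠ j.succ := by simp [Fin.ext_iff]; omega
      have b1 : s j i.castSucc = i.castSucc := s_of_ne j (a1 ▸ a3) a2
      have b2 : s i j.succ = j.succ := s_of_ne i a2.symm a4.symm
      have b3 : s j i.succ = j.succ := by rw [← a1, s_castSucc]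
      have b4 : s j j.succ = i.succ := by rw [← a1, s_succ]
      have hcomm := s_mul_s_mul_s_mul_of_adj hn' w
      -- Now the prefix `s i * s j * s i` is removed. Since `w⁻¹` decreases along `i, i + 1, i + 2`,
      -- each letter put back increases the length.
      obtain ⟨w', hw'⟩ : ∃ w', w' = s i * (s j * (s i * w)) := ⟨_, rfl⟩
      have hK := reducedWord_spec w'
      rw [a1] at hj
      have e1 : IsReducedWord (s j * (s i * w)) (i :: reducedWord w') := by
        have := hK.cons (i := i) (by
          rw [hw']
          simp only [s_mul_inv_apply, s_castSucc, s_succ, b1, b2, b3]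
          exact hj)
        rwa [hw', s_mul_s_mul, ← hw'] at this
      have e1' : IsReducedWord (s i * w) (j :: i :: reducedWord w') := by
        have := e1.cons (i := j) (by
          simp only [s_mul_inv_apply, a1, b3, b4, b2, s_succ]
          exact hj.trans hi)
        rwa [s_mul_s_mul] at this
      have e2 : IsReducedWord (s i * (s j * w)) (j :: reducedWord w') := by
        have := hK.cons (i := j) (by
          rw [hw', hcomm]
          simp only [s_mul_inv_apply, s_succ, a1, b1, b2, b3, b4]
          exact hi)
        rwa [hw', hcomm, s_mul_s_mul, ← hcomm, ← hw'] at this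
      have e2' : IsReducedWord (s j * w) (i :: j :: reducedWord w') := by
        have := e2.cons (i := i) (by
          simp only [s_mul_inv_apply, s_castSucc, s_succ, b1, b3]
          exact hj.trans hi)
        rwa [s_mul_s_mul] at this
      rw [ih _ hlt hMr e1' rfl, ih _ hlt' hMr' e2' rfl]
      simp only [List.map_cons, List.prod_cons, ← mul_assoc]
      rw [hbraid i j hn']
  have hlen : L.length = L'.length := hL.length_eq.trans hL'.length_eq.symm
  match L, L', hL, hL' with
  | [], [], _, _ => rfl
  | i :: M, [], _, _ => simp at hlen
  | [], j :: M', _, _ => simp at hlen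
  | i :: M, j :: M', hL, hL' =>
    rw [List.length_cons, List.length_cons] at hlen
    rw [List.map_cons, List.map_cons, List.prod_cons, List.prod_cons]
    rcases lt_trichotomy i j with h | rfl | h
    · exact main i j M M' h hL hL' (by simp) (by simp; omega)
    · rw [ih _ (by simp) hL.of_cons.2 hL'.of_cons.2 rfl]
    · exact (main j i M' M h hL' hL (by simp; omega) (by simp)).symm

variable {m : ℕ}

/-! ### Multiplication of the elements `T_w` by generators -/

theorem TUnit_braid (i j : Fin m) (h : (i : ℕ) + 1 = j) :
    TUnit i * TUnit j * TUnit i = TUnit j * TUnit i * TUnit j := by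
  have h := RingQuot.mkAlgHom_rel R (Rel.braid i j h)
  ext
  rw [map_mul, map_mul, map_mul, map_mul] at h
  exact h

theorem TUnit_far (i j : Fin m) (h : (i : ℕ) + 1 < j) :
    TUnit i * TUnit j = TUnit j * TUnit i := by
  have h := RingQuot.mkAlgHom_rel R (Rel.far i j (Or.inl h))
  ext
  rw [map_mul, map_mul] at h
  exact h

theorem IsReducedWord.Tw_eq {w : Equiv.Perm (Fin (m + 1))} {L : List (Fin m)}
    (hL : IsReducedWord w L) : Tw w = (L.map TUnit).prod :=
  (reducedWord_spec w).prod_map_eq TUnit_braid TUnit_far hL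

theorem Tw_one : Tw (1 : Equiv.Perm (Fin (m + 1))) = 1 :=
  IsReducedWord.Tw_eq (L := []) ⟨rfl, fun _ _ => Nat.zero_le _⟩

theorem TUnit_mul_Tw {i : Fin m} {w : Equiv.Perm (Fin (m + 1))}
    (h : w⁻¹ i.castSucc < w⁻¹ i.succ) : TUnit i * Tw w = Tw (s i * w) := by
  rw [((reducedWord_spec w).cons h).Tw_eq, List.map_cons, List.prod_cons, Tw]

theorem Tw_inv_mul_TUnit {i : Fin m} {w : Equiv.Perm (Fin (m + 1))}
    (h : w⁻¹ i.castSucc < w⁻¹ i.succ) : Tw w⁻¹ * TUnit i = Tw (s i * w)⁻¹ := by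
  rw [((reducedWord_spec w).cons h).reverse.Tw_eq, (reducedWord_spec w).reverse.Tw_eq,
    List.reverse_cons, List.map_append, List.prod_append, List.map_singleton, List.prod_singleton]

theorem T_mul_Tw_of_lt {i : Fin m} {w : Equiv.Perm (Fin (m + 1))}
    (h : w⁻¹ i.castSucc < w⁻¹ i.succ) : T i * (Tw w : H m) = Tw (s i * w) := by
  rw [← TUnit_mul_Tw h]; rfl

theorem T_mul_Tw_of_gt {i : Fin m} {w : Equiv.Perm (Fin (m + 1))}
    (h : w⁻¹ i.succ < w⁻¹ i.castSucc) :
    T i * (Tw w : H m) = (t - 1) • (Tw w : H m) + t • (Tw (s i * w) : H m) := by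
  have h1 : T i * (Tw (s i * w) : H m) = Tw w := by
    rw [T_mul_Tw_of_lt (by simpa [s_mul_inv_apply] using h), s_mul_s_mul]
  rw [← h1, ← mul_assoc, T_mul_T, add_mul, smul_mul_assoc, smul_mul_assoc, one_mul]

/-- `t T_i⁻¹`. -/
def Tbar (i : Fin m) : H m := T i + (1 - t) • 1

theorem t_smul_TUnit_inv (i : Fin m) : t • (((TUnit i)⁻¹ : (H m)ˣ) : H m) = Tbar i := by
  change t • (tInv • (T i + (1 - t) • 1)) = _
  rw [smul_smul, t_mul_tInv, one_smul, Tbar]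

theorem Tbar_mul (i : Fin m) (y : H m) : Tbar i * y = T i * y + (1 - t) • y := by
  rw [Tbar, add_mul, smul_mul_assoc, one_mul]

theorem T_mul_Tbar (i : Fin m) : T i * Tbar i = t • (1 : H m) := by
  rw [Tbar, mul_add, T_mul_T, mul_smul_comm, mul_one]; module

@[simp] theorem apply_inv_self (w : Equiv.Perm (Fin (m + 1))) (a : Fin (m + 1)) :
    w (w⁻¹ a) = a := Equiv.apply_symm_apply w a

/-! ### Stabilizers and the permutations `u_C` -/

theorem mem_stab {lam : Fin (m + 1) → ℕ} {w : Equiv.Perm (Fin (m + 1))} :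
    w ∈ stab lam ↔ ∀ a, lam (w a) = lam a := by
  rw [stab, Finset.mem_filter, funext_iff]
  simp only [Finset.mem_univ, true_and]
  exact ⟨fun h a => by simpa using (h (w a)).symm, fun h a => by simpa using (h (w⁻¹ a)).symm⟩

theorem mem_stab_varpi {l : ℕ} {w : Equiv.Perm (Fin (m + 1))} :
    w ∈ stab (varpi m l) ↔ ∀ a, ((w a : Fin (m + 1)) : ℕ) < l ↔ (a : ℕ) < l := by
  rw [mem_stab]
  refine forall_congr' fun a => ?_
  unfold varpi
  split_ifs <;> simp [*]

theorem one_mem_stab (lam : Fin (m + 1) → ℕ) : 1 ∈ stab lam := mem_stab.2 fun _ => rfl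

theorem mul_mem_stab {lam : Fin (m + 1) → ℕ} {v w : Equiv.Perm (Fin (m + 1))}
    (hv : v ∈ stab lam) (hw : w ∈ stab lam) : v * w ∈ stab lam := by
  rw [mem_stab] at *
  intro a
  rw [Equiv.Perm.mul_apply, hv, hw]

theorem s_mem_stab {lam : Fin (m + 1) → ℕ} {i : Fin m} (h : lam i.castSucc = lam i.succ) :
    s i ∈ stab lam := by
  rw [mem_stab]
  intro a
  by_cases h1 : a = i.castSucc
  · rw [h1, s_castSucc, h]
  by_cases h2 : a = i.succ
  · rw [h2, s_succ, h]
  rw [s_of_ne i h1 h2]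

theorem mem_sAct {j : Fin m} {C : Column m} {a : Fin (m + 1)} : a ∈ sAct j C ↔ s j a ∈ C := by
  have e : (s j).symm = s j := s_inv j
  rw [sAct, Finset.mem_map_equiv, e]

@[simp] theorem card_sAct (j : Fin m) (C : Column m) : (sAct j C).card = C.card :=
  Finset.card_map _

@[simp] theorem sAct_sAct (j : Fin m) (C : Column m) : sAct j (sAct j C) = C := by
  ext a; simp [mem_sAct]

theorem sAct_eq_self {j : Fin m} {C : Column m} (h : j.castSucc ∈ C ↔ j.succ ∈ C) :
    sAct j C = C := by
  ext a
  rw [mem_sAct]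
  by_cases h1 : a = j.castSucc
  · rw [h1, s_castSucc, h]
  by_cases h2 : a = j.succ
  · rw [h2, s_succ, h]
  rw [s_of_ne j h1 h2]

theorem u_apply_of_lt (C : Column m) {a : Fin (m + 1)} (h : (a : ℕ) < C.card) :
    u C a = C.orderEmbOfFin rfl ⟨a, h⟩ := by
  have e : finCongr (show m + 1 = C.card + Cᶜ.card by
      rw [Finset.card_add_card_compl, Fintype.card_fin]) a = Fin.castAdd _ ⟨a, h⟩ := rfl
  simp only [u, Equiv.trans_apply, e, finSumFinEquiv_symm_apply_castAdd,
    finSumEquivOfFinset_inl]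

theorem u_apply_of_ge (C : Column m) {a : Fin (m + 1)} (h : C.card ≤ (a : ℕ)) :
    ∃ h' : (a : ℕ) - C.card < Cᶜ.card, u C a = Cᶜ.orderEmbOfFin rfl ⟨a - C.card, h'⟩ := by
  have hc : m + 1 = C.card + Cᶜ.card := by rw [Finset.card_add_card_compl, Fintype.card_fin]
  have h' : (a : ℕ) - C.card < Cᶜ.card := by omega
  refine ⟨h', ?_⟩
  have e : finCongr hc a = Fin.natAdd _ ⟨a - C.card, h'⟩ := by
    ext; simp; omega
  simp only [u, Equiv.trans_apply, e, finSumFinEquiv_symm_apply_natAdd,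
    finSumEquivOfFinset_inr]

theorem u_mem_iff (C : Column m) (a : Fin (m + 1)) : u C a ∈ C ↔ (a : ℕ) < C.card := by
  rcases Nat.lt_or_ge (a : ℕ) C.card with h | h
  · rw [u_apply_of_lt C h]
    exact iff_of_true (Finset.orderEmbOfFin_mem _ _ _) h
  · obtain ⟨h', e⟩ := u_apply_of_ge C h
    rw [e]
    exact iff_of_false (Finset.mem_compl.1 (Finset.orderEmbOfFin_mem _ _ _)) h.not_gt

theorem u_lt_u (C : Column m) {a b : Fin (m + 1)} (hab : a < b)
    (h : (a : ℕ) < C.card ↔ (b : ℕ) < C.card) : u C a < u C b := by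
  rcases Nat.lt_or_ge (a : ℕ) C.card with ha | ha
  · rw [u_apply_of_lt C ha, u_apply_of_lt C (h.1 ha), OrderEmbedding.lt_iff_lt]
    exact hab
  · obtain ⟨h1, e1⟩ := u_apply_of_ge C ha
    obtain ⟨h2, e2⟩ := u_apply_of_ge C (a := b) (by rw [Fin.lt_def] at hab; omega)
    rw [e1, e2, OrderEmbedding.lt_iff_lt, Fin.mk_lt_mk]
    rw [Fin.lt_def] at hab; omega

theorem lt_card_iff (C : Column m) (a : Fin (m + 1)) :
    (((u C)⁻¹ a : Fin (m + 1)) : ℕ) < C.card ↔ a ∈ C := by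
  rw [← u_mem_iff, apply_inv_self]

theorem u_inv_lt_u_inv (C : Column m) {a b : Fin (m + 1)} (hab : a < b)
    (h : a ∈ C ↔ b ∈ C) : (u C)⁻¹ a < (u C)⁻¹ b := by
  rcases lt_trichotomy ((u C)⁻¹ a) ((u C)⁻¹ b) with h1 | h1 | h1
  · exact h1
  · exact absurd ((u C)⁻¹.injective h1) hab.ne
  · have := u_lt_u C h1 (by rw [lt_card_iff, lt_card_iff, h])
    simp only [apply_inv_self] at this
    exact absurd this hab.not_gt

/-- The hypotheses make `(u C)⁻¹ * w` strictly increasing, and the identity is the only such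
permutation. -/
theorem eq_u (C : Column m) {w : Equiv.Perm (Fin (m + 1))}
    (h : ∀ a, w a ∈ C ↔ (a : ℕ) < C.card)
    (hw : ∀ a b : Fin (m + 1), a < b → ((a : ℕ) < C.card ↔ (b : ℕ) < C.card) → w a < w b) :
    w = u C := by
  have key : StrictMono ((u C)⁻¹ * w : Equiv.Perm (Fin (m + 1))) := by
    intro a b hab
    simp only [Equiv.Perm.mul_apply]
    by_cases hc : (a : ℕ) < C.card ↔ (b : ℕ) < C.card
    · exact u_inv_lt_u_inv C (hw a b hab hc) (by rw [h, h, hc])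
    · have h1 := lt_card_iff C (w a)
      have h2 := lt_card_iff C (w b)
      rw [h] at h1 h2
      rw [Fin.lt_def] at *
      by_cases ha : (a : ℕ) < C.card
      · have hb : ¬ (b : ℕ) < C.card := fun hb => hc (iff_of_true ha hb)
        have := h1.2 ha
        have := mt h2.1 hb
        omega
      · exact absurd (iff_of_false ha (by omega)) hc
  rw [← mul_one (u C), ← eq_one_of_strictMono key, mul_inv_cancel_left]

theorem u_of_isHighestColumn {C : Column m} (h : IsHighestColumn C) : u C = 1 := by
  refine (eq_u C (fun a => ?_) fun a b hab _ => hab).symm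
  conv_lhs => rw [h]
  simp

/-- As `i` and `i + 1` lie in different blocks, exchanging them leaves both blocks increasing. -/
theorem u_sAct {i : Fin m} {C : Column m} (h₁ : i.castSucc ∈ C) (h₂ : i.succ ∉ C) :
    u (sAct i C) = s i * u C := by
  symm
  refine eq_u _ (fun a => ?_) fun a b hab h => ?_
  · rw [Equiv.Perm.mul_apply, mem_sAct, s_s, u_mem_iff, card_sAct]
  · rw [card_sAct] at h
    rw [Equiv.Perm.mul_apply, Equiv.Perm.mul_apply]
    refine s_lt_s i (u_lt_u C hab h) fun hc => h₂ ?_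
    rw [← hc.2, u_mem_iff, ← h, ← u_mem_iff, hc.1]
    exact h₁

theorem isHighestColumn_of_isLowerSet {C : Column m} (h : IsLowerSet (C : Set (Fin (m + 1)))) :
    IsHighestColumn C := by
  refine Finset.eq_of_subset_of_card_le (fun b hb => ?_) ?_
  · rw [Finset.mem_filter]
    refine ⟨Finset.mem_univ _, ?_⟩
    have : Finset.Iic b ⊆ C := fun a ha => h (Finset.mem_Iic.1 ha) hb
    have := Finset.card_le_card this
    rw [Fin.card_Iic] at this
    omega
  · rw [Fin.card_filter_val_lt]
    exact min_le_right _ _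

/-- Every column arises from the initial one of its length by raising an entry `i` to a free value
`i + 1`; the sum of the entries measures progress. Each step puts a factor `T_i` in front of
`T_{u_C}` and a factor `t T_i⁻¹` in front of `lead C`. -/
theorem column_induction {P : Column m → Prop} (h0 : ∀ C, IsHighestColumn C → P C)
    (hs : ∀ C (i : Fin m), i.castSucc ∈ C → i.succ ∉ C → P C → P (sAct i C)) (C : Column m) :
    P C := by
  induction hN : ∑ a ∈ C, (a : ℕ) using Nat.strong_induction_on generalizing C with
  | _ N ih =>
  subst hN
  by_cases hC : ∃ i : Fin m, i.castSucc ∉ C ∧ i.succ ∈ C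
  · obtain ⟨i, h1, h2⟩ := hC
    have hlt : ∑ a ∈ sAct i C, (a : ℕ) < ∑ a ∈ C, (a : ℕ) := by
      rw [sAct, Finset.sum_map]
      refine Finset.sum_lt_sum (fun a ha => ?_) ⟨i.succ, h2, by simp⟩
      by_cases h4 : a = i.succ
      · simp [h4]
      · simp [s_of_ne i (fun h => h1 (h ▸ ha)) h4]
    have := hs (sAct i C) i (by simpa [mem_sAct] using h2) (by simpa [mem_sAct] using h1)
      (ih _ hlt _ rfl)
    rwa [sAct_sAct] at this
  · push Not at hC
    apply h0
    have hdown : ∀ b a : Fin (m + 1), a ≤ b → b ∈ C → a ∈ C := by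
      intro b
      induction b using Fin.induction with
      | zero => intro a ha hb; rwa [Fin.le_zero_iff.1 ha]
      | succ i ih =>
        intro a ha hb
        rcases ha.lt_or_eq with h | rfl
        · exact ih a (Fin.le_castSucc_iff.2 h) (by_contra fun hc => hC i hc hb)
        · exact hb
    exact isHighestColumn_of_isLowerSet fun b a hab hb => hdown b a hab hb

/-! ### The elements `T_{u_C}` and their lifts -/

theorem Tw_u_sAct {i : Fin m} {C : Column m} (h₁ : i.castSucc ∈ C) (h₂ : i.succ ∉ C) :
    (Tw (u (sAct i C)) : H m) = T i * Tw (u C) := by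
  rw [u_sAct h₁ h₂, T_mul_Tw_of_lt]
  have h1 := (lt_card_iff C i.castSucc).2 h₁
  have h2 := mt (lt_card_iff C i.succ).1 h₂
  rw [Fin.lt_def]; omega

theorem lead_of_isHighestColumn {C : Column m} (h : IsHighestColumn C) : lead C = 1 := by
  rw [lead, u_of_isHighestColumn h, inv_one, Tw_one, inv_one, Units.val_one,
    len_eq_card_inversions]
  have : (inversions (1 : Equiv.Perm (Fin (m + 1)))).card = 0 := by
    simpa using card_inversions_le (m := m) []
  rw [this, pow_zero, one_smul]

theorem lead_sAct {i : Fin m} {C : Column m} (h₁ : i.castSucc ∈ C) (h₂ : i.succ ∉ C) :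
    lead (sAct i C) = Tbar i * lead C := by
  have hlt : (u C)⁻¹ i.castSucc < (u C)⁻¹ i.succ := by
    have h1 := (lt_card_iff C i.castSucc).2 h₁
    have h2 := mt (lt_card_iff C i.succ).1 h₂
    rw [Fin.lt_def]; omega
  rw [lead, lead, u_sAct h₁ h₂, len_s_mul hlt, ← Tw_inv_mul_TUnit hlt, mul_inv_rev, Units.val_mul,
    ← t_smul_TUnit_inv, smul_mul_smul_comm, ← pow_succ']

/-- `u C` is the shortest element of its coset. In the inductive step `v` preserves the first block
of positions, so `i` still stands before `i + 1` in `u C * v`. -/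
theorem Tw_u_mul {C : Column m} {v : Equiv.Perm (Fin (m + 1))} (hv : v ∈ stab (varpi m C.card)) :
    (Tw (u C * v) : H m) = Tw (u C) * Tw v := by
  induction C using column_induction with
  | h0 C h => rw [u_of_isHighestColumn h, one_mul, Tw_one, Units.val_one, one_mul]
  | hs C i h₁ h₂ ih =>
    rw [card_sAct] at hv
    rw [Tw_u_sAct h₁ h₂, mul_assoc, ← ih hv, u_sAct h₁ h₂, mul_assoc, T_mul_Tw_of_lt]
    have h1 := (lt_card_iff C i.castSucc).2 h₁
    have h2 := mt (lt_card_iff C i.succ).1 h₂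
    rw [mem_stab_varpi] at hv
    rw [← apply_inv_self v ((u C)⁻¹ i.castSucc), hv] at h1
    rw [← apply_inv_self v ((u C)⁻¹ i.succ), hv] at h2
    rw [mul_inv_rev, Equiv.Perm.mul_apply, Equiv.Perm.mul_apply, Fin.lt_def]
    omega

/-- If `s_j C = C` then `T_j` moves across `T_{u_C}` and across its lift, and becomes a generator of
the parabolic subalgebra. -/
theorem exists_T_mul_eq {j : Fin m} {C : Column m} (h : j.castSucc ∈ C ↔ j.succ ∈ C) :
    ∃ i : Fin m, s i ∈ stab (varpi m C.card) ∧
      T j * (Tw (u C) : H m) = Tw (u C) * T i ∧ T j * lead C = lead C * T i := by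
  have hlt := u_inv_lt_u_inv C (Fin.castSucc_lt_succ (i := j)) h
  -- The values `j` and `j + 1` occupy consecutive positions: they lie in one block, and an entry
  -- between them would have a value strictly between `j` and `j + 1`.
  have hadj : (((u C)⁻¹ j.castSucc : Fin (m + 1)) : ℕ) + 1 = ((u C)⁻¹ j.succ : Fin (m + 1)) := by
    by_contra hne
    rw [Fin.lt_def] at hlt
    have h1 := lt_card_iff C j.castSucc
    have h2 := lt_card_iff C j.succ
    obtain ⟨r, hr⟩ : ∃ r : Fin (m + 1), (r : ℕ) = ((u C)⁻¹ j.castSucc : Fin (m + 1)) + 1 :=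
      ⟨⟨_, by have := ((u C)⁻¹ j.succ).isLt; omega⟩, rfl⟩
    have e1 := u_lt_u C (a := (u C)⁻¹ j.castSucc) (b := r) (by rw [Fin.lt_def]; omega)
      (by by_cases hj : j.succ ∈ C
          · have := h2.2 hj
            exact iff_of_true (by omega) (by omega)
          · have := mt h1.1 (mt h.1 hj)
            exact iff_of_false (by omega) (by omega))
    have e2 := u_lt_u C (a := r) (b := (u C)⁻¹ j.succ) (by rw [Fin.lt_def]; omega)
      (by by_cases hj : j.succ ∈ C
          · have := h2.2 hj
            exact iff_of_true (by omega) (by omega)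
          · have := mt h1.1 (mt h.1 hj)
            exact iff_of_false (by omega) (by omega))
    rw [apply_inv_self, Fin.lt_def] at e1 e2
    simp only [Fin.val_castSucc, Fin.val_succ] at e1 e2
    omega
  obtain ⟨i, hi⟩ : ∃ i : Fin m, (u C)⁻¹ j.castSucc = i.castSucc :=
    ⟨⟨((u C)⁻¹ j.castSucc : Fin (m + 1)), by have := ((u C)⁻¹ j.succ).isLt; omega⟩, rfl⟩
  have hi' : (u C)⁻¹ j.succ = i.succ := by
    rw [Fin.ext_iff, ← hadj, hi]; rfl
  have k1 : u C i.castSucc = j.castSucc := by rw [← hi, apply_inv_self]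
  have k2 : u C i.succ = j.succ := by rw [← hi', apply_inv_self]
  have hmem : s i ∈ stab (varpi m C.card) := by
    refine s_mem_stab ?_
    have : ((i.castSucc : Fin (m + 1)) : ℕ) < C.card ↔ ((i.succ : Fin (m + 1)) : ℕ) < C.card := by
      rw [← u_mem_iff, ← u_mem_iff, k1, k2, h]
    simp only [varpi, this]
  have hcomm : s j * u C = u C * s i := by
    rw [s, s, Equiv.mul_swap_eq_swap_mul, k1, k2]
  have hTi : (Tw (s i) : H m) = T i := by
    have := T_mul_Tw_of_lt (i := i) (w := 1) (by simp [Fin.lt_def])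
    rwa [Tw_one, Units.val_one, mul_one, mul_one, eq_comm] at this
  refine ⟨i, hmem, ?_, ?_⟩
  · rw [T_mul_Tw_of_lt hlt, hcomm, Tw_u_mul hmem, hTi]
  · have e : Tw (u C)⁻¹ * TUnit j = TUnit i * Tw (u C)⁻¹ := by
      rw [Tw_inv_mul_TUnit hlt, TUnit_mul_Tw, hcomm, mul_inv_rev, s_inv]
      rw [inv_inv, k1, k2]
      exact Fin.castSucc_lt_succ
    have e' : TUnit j * (Tw (u C)⁻¹)⁻¹ = (Tw (u C)⁻¹)⁻¹ * TUnit i := by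
      rw [eq_inv_mul_iff_mul_eq, ← mul_assoc, e, mul_inv_cancel_right]
    have e'' := congrArg Units.val e'
    rw [Units.val_mul, Units.val_mul] at e''
    rw [lead, mul_smul_comm, smul_mul_assoc]
    congr 1

/-! ### Representations of the finite Hecke algebra extend to the affine one -/

section Evaluation

variable {A : Type*} [Ring A] [Algebra R A] (τ : Fin m → A)

/-- The Jucys–Murphy elements `t^{-k} τ_{k-1} ⋯ τ_0 τ_0 ⋯ τ_{k-1}`. -/
def jucysMurphy : Fin (m + 1) → A :=
  Fin.induction 1 fun i x => tInv • (τ i * x * τ i)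

@[simp] theorem jucysMurphy_succ (i : Fin m) :
    jucysMurphy τ i.succ = tInv • (τ i * jucysMurphy τ i.castSucc * τ i) := rfl

variable {τ}

theorem commute_jucysMurphy_of_lt
    (hfar : ∀ i j : Fin m, (i : ℕ) + 1 < j → τ i * τ j = τ j * τ i)
    {i : Fin m} {k : Fin (m + 1)} (h : (k : ℕ) < i) : Commute (τ i) (jucysMurphy τ k) := by
  induction k using Fin.induction with
  | zero => exact Commute.one_right _
  | succ k ih =>
    rw [Fin.val_succ] at h
    have h1 : Commute (τ i) (τ k) := (hfar k i h).symm
    rw [jucysMurphy_succ]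
    exact ((h1.mul_right (ih (by rw [Fin.val_castSucc]; omega))).mul_right h1).smul_right _

/-- The critical case is `k = i + 2`. Two braid relations carry `τ i` through as `τ (i + 1)`, which
commutes with the Jucys–Murphy element of index `i` in the middle. -/
theorem commute_jucysMurphy_of_gt
    (hbraid : ∀ i j : Fin m, (i : ℕ) + 1 = j → τ i * τ j * τ i = τ j * τ i * τ j)
    (hfar : ∀ i j : Fin m, (i : ℕ) + 1 < j → τ i * τ j = τ j * τ i)
    {i : Fin m} {k : Fin (m + 1)} (h : (i : ℕ) + 1 < k) : Commute (τ i) (jucysMurphy τ k) := by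
  induction k using Fin.induction with
  | zero => exact Commute.one_right _
  | succ k ih =>
    rw [Fin.val_succ] at h
    rw [jucysMurphy_succ]
    rcases Nat.lt_or_ge ((i : ℕ) + 1) k with hk | hk
    · have h1 : Commute (τ i) (τ k) := hfar i k hk
      exact ((h1.mul_right (ih (by rw [Fin.val_castSucc]; omega))).mul_right h1).smul_right _
    · have e : k.castSucc = i.succ := by ext; rw [Fin.val_castSucc, Fin.val_succ]; omega
      rw [e, jucysMurphy_succ, mul_smul_comm, smul_mul_assoc]
      refine (Commute.smul_right ?_ _).smul_right _
      have hb := hbraid i k (by omega)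
      have hc : τ k * jucysMurphy τ i.castSucc = jucysMurphy τ i.castSucc * τ k :=
        commute_jucysMurphy_of_lt hfar (by rw [Fin.val_castSucc]; omega)
      generalize jucysMurphy τ i.castSucc = x at hc
      change τ i * (τ k * (τ i * x * τ i) * τ k) = τ k * (τ i * x * τ i) * τ k * τ i
      calc τ i * (τ k * (τ i * x * τ i) * τ k) = (τ i * τ k * τ i) * x * τ i * τ k := by
            simp only [mul_assoc]
        _ = τ k * τ i * (τ k * x) * τ i * τ k := by rw [hb]; simp only [mul_assoc]
        _ = τ k * τ i * x * (τ k * τ i * τ k) := by rw [hc]; simp only [mul_assoc]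
        _ = τ k * (τ i * x * τ i) * τ k * τ i := by rw [← hb]; simp only [mul_assoc]

theorem commute_jucysMurphy
    (hbraid : ∀ i j : Fin m, (i : ℕ) + 1 = j → τ i * τ j * τ i = τ j * τ i * τ j)
    (hfar : ∀ i j : Fin m, (i : ℕ) + 1 < j → τ i * τ j = τ j * τ i)
    {k l : Fin (m + 1)} (h : (k : ℕ) < l) : Commute (jucysMurphy τ k) (jucysMurphy τ l) := by
  induction k using Fin.induction with
  | zero => exact Commute.one_left _
  | succ k ih =>
    rw [Fin.val_succ] at h
    have h1 := commute_jucysMurphy_of_gt hbraid hfar h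
    rw [jucysMurphy_succ]
    exact ((h1.mul_left (ih (by rw [Fin.val_castSucc]; omega))).mul_left h1).smul_left _

theorem isUnit_of_quad {x : A} (hx : x * x = (t - 1) • x + t • (1 : A)) : IsUnit x := by
  have e : (t - 1) • x + t • (1 : A) + (1 - t) • x = t • (1 : A) := by module
  refine ⟨⟨x, tInv • (x + (1 - t) • 1), ?_, ?_⟩, rfl⟩
  · rw [mul_smul_comm, mul_add, hx, mul_smul_comm, mul_one, e, smul_smul, tInv_mul_t, one_smul]
  · rw [smul_mul_assoc, add_mul, hx, smul_mul_assoc, one_mul, e, smul_smul, tInv_mul_t, one_smul]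

theorem isUnit_jucysMurphy (hquad : ∀ i, τ i * τ i = (t - 1) • τ i + t • (1 : A))
    (k : Fin (m + 1)) : IsUnit (jucysMurphy τ k) := by
  induction k using Fin.induction with
  | zero => exact isUnit_one
  | succ k ih =>
    rw [jucysMurphy_succ, Algebra.smul_def]
    have h := isUnit_of_quad (hquad k)
    refine IsUnit.mul (IsUnit.map _ ?_) ((h.mul ih).mul h)
    exact IsUnit.of_mul_eq_one _ tInv_mul_t

/-- The homomorphism from `H` to an algebra with a family satisfying the relations of the finite
Hecke algebra, sending the `X_k` to the Jucys–Murphy elements. -/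
theorem exists_evaluation (hquad : ∀ i, τ i * τ i = (t - 1) • τ i + t • (1 : A))
    (hbraid : ∀ i j : Fin m, (i : ℕ) + 1 = j → τ i * τ j * τ i = τ j * τ i * τ j)
    (hfar : ∀ i j : Fin m, (i : ℕ) + 1 < j → τ i * τ j = τ j * τ i) :
    ∃ f : H m →ₐ[R] A, ∀ i, f (T i) = τ i := by
  let g : Gen m → A := fun x => match x with
    | Gen.T i => τ i
    | Gen.X k => jucysMurphy τ k
    | Gen.Xinv k => Ring.inverse (jucysMurphy τ k)
  let F : FreeAlgebra R (Gen m) →ₐ[R] A := FreeAlgebra.lift R g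
  have hT : ∀ i, F (fT i) = τ i := fun i => FreeAlgebra.lift_ι_apply _ _
  have hX : ∀ k, F (fX k) = jucysMurphy τ k := fun i => FreeAlgebra.lift_ι_apply _ _
  have hXi : ∀ k, F (fXinv k) = Ring.inverse (jucysMurphy τ k) :=
    fun i => FreeAlgebra.lift_ι_apply _ _
  have hF : ∀ ⦃x y⦄, Rel m x y → F x = F y := by
    intro x y hxy
    cases hxy with
    | quad i => simp only [map_mul, map_add, map_smul, map_one, hT, hquad]
    | braid i j h => simp only [map_mul, hT, hbraid i j h]
    | far i j h =>
      simp only [map_mul, hT]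
      rcases h with h | h
      · exact hfar i j h
      · exact (hfar j i h).symm
    | X_mul_Xinv k =>
      simp only [map_mul, map_one, hX, hXi]
      exact Ring.mul_inverse_cancel _ (isUnit_jucysMurphy hquad k)
    | Xinv_mul_X k =>
      simp only [map_mul, map_one, hX, hXi]
      exact Ring.inverse_mul_cancel _ (isUnit_jucysMurphy hquad k)
    | X_comm k l =>
      simp only [map_mul, hX]
      rcases lt_trichotomy k l with h | rfl | h
      · exact commute_jucysMurphy hbraid hfar h
      · rfl
      · exact (commute_jucysMurphy hbraid hfar h).symm
    | TXT i =>
      simp only [map_mul, map_smul, hX, hT, jucysMurphy_succ, smul_smul, t_mul_tInv, one_smul]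
    | TX_comm i k h₁ h₂ =>
      simp only [map_mul, hX, hT]
      rw [Ne, Fin.ext_iff] at h₁ h₂
      rw [Fin.val_castSucc] at h₁
      rw [Fin.val_succ] at h₂
      rcases Nat.lt_or_ge (k : ℕ) i with h | h
      · exact commute_jucysMurphy_of_lt hfar h
      · exact commute_jucysMurphy_of_gt hbraid hfar (by omega)
  refine ⟨RingQuot.liftAlgHom R ⟨F, hF⟩, fun i => ?_⟩
  rw [T, RingQuot.liftAlgHom_mkAlgHom_apply, hT]

end Evaluation

/-! ### The regular representation -/

section Regular

/-- The action of `T_i` in the left regular representation of the finite Hecke algebra. -/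
def regular (i : Fin m) : Module.End R (Equiv.Perm (Fin (m + 1)) →₀ R) :=
  Finsupp.linearCombination R fun w => if w⁻¹ i.castSucc < w⁻¹ i.succ
    then Finsupp.single (s i * w) 1
    else (t - 1) • Finsupp.single w 1 + t • Finsupp.single (s i * w) 1

theorem regular_single (i : Fin m) (w : Equiv.Perm (Fin (m + 1))) :
    regular i (Finsupp.single w 1) = if w⁻¹ i.castSucc < w⁻¹ i.succ
      then Finsupp.single (s i * w) 1
      else (t - 1) • Finsupp.single w 1 + t • Finsupp.single (s i * w) 1 := by
  rw [regular, Finsupp.linearCombination_single, one_smul]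

theorem end_ext {f g : Module.End R (Equiv.Perm (Fin (m + 1)) →₀ R)}
    (h : ∀ w, f (Finsupp.single w 1) = g (Finsupp.single w 1)) : f = g :=
  Finsupp.lhom_ext' fun w => LinearMap.ext_ring (h w)

theorem regular_quad (i : Fin m) :
    regular i * regular i = (t - 1) • regular i + t • (1 : Module.End R _) := by
  refine end_ext fun w => ?_
  simp only [Module.End.mul_apply, LinearMap.add_apply, LinearMap.smul_apply, Module.End.one_apply]
  rcases lt_or_gt_of_ne (inv_castSucc_ne_inv_succ i w) with h | h
  · simp only [regular_single, h, if_true, s_mul_inv_apply, s_castSucc, s_succ, h.not_gt, if_false,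
      s_mul_s_mul]
  · simp only [regular_single, h.not_gt, h, if_true, s_mul_inv_apply, s_castSucc, s_succ, if_false,
      s_mul_s_mul, map_add, map_smul]

theorem regular_far (i j : Fin m) (h : (i : ℕ) + 1 < j) :
    regular i * regular j = regular j * regular i := by
  have d1 : j.castSucc ≠ i.castSucc := by simp [Fin.ext_iff]; omega
  have d2 : j.castSucc ≠ i.succ := by simp [Fin.ext_iff]; omega
  have d3 : j.succ ≠ i.castSucc := by simp [Fin.ext_iff]; omega
  have d4 : j.succ ≠ i.succ := by simp [Fin.ext_iff]; omega
  refine end_ext fun w => ?_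
  have hcomm := s_mul_s_mul_of_far h w
  simp only [Module.End.mul_apply]
  rcases lt_or_gt_of_ne (inv_castSucc_ne_inv_succ i w) with hi | hi <;>
  rcases lt_or_gt_of_ne (inv_castSucc_ne_inv_succ j w) with hj | hj <;>
  · simp only [regular_single, hi, hj, hi.not_gt, hj.not_gt, if_true, if_false, s_mul_inv_apply,
      map_add, map_smul, s_of_ne i d1 d2, s_of_ne i d3 d4, s_of_ne j d1.symm d3.symm,
      s_of_ne j d2.symm d4.symm, hcomm]
    try module

/-- On the basis vector of `w` both sides depend only on the relative order of `w⁻¹ i`, `w⁻¹ (i +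
1)`, `w⁻¹ (i + 2)`. Of the eight combinations of comparisons, two are inconsistent and six are
computed. -/
theorem regular_braid (i j : Fin m) (h : (i : ℕ) + 1 = j) :
    regular i * regular j * regular i = regular j * regular i * regular j := by
  have a1 : j.castSucc = i.succ := by simp [Fin.ext_iff]; omega
  have a2 : i.castSucc ≠ j.succ := by simp [Fin.ext_iff]; omega
  have a3 : i.castSucc ≠ i.succ := by simp [Fin.ext_iff]
  have a4 : i.succ ≠ j.succ := by simp [Fin.ext_iff]; omega
  have b1 : s j i.castSucc = i.castSucc := s_of_ne j (a1 ▸ a3) a2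
  have b2 : s i j.succ = j.succ := s_of_ne i a2.symm a4.symm
  have b3 : s j i.succ = j.succ := by rw [← a1, s_castSucc]
  have b4 : s j j.succ = i.succ := by rw [← a1, s_succ]
  refine end_ext fun w => ?_
  have hcomm := s_mul_s_mul_s_mul_of_adj h w
  simp only [Module.End.mul_apply]
  have hj := inv_castSucc_ne_inv_succ j w
  have hij : w⁻¹ i.castSucc ≠ w⁻¹ j.succ := fun h => a2 (w⁻¹.injective h)
  rw [a1] at hj
  rcases lt_or_gt_of_ne (inv_castSucc_ne_inv_succ i w) with h1 | h1 <;>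
  rcases lt_or_gt_of_ne hj with h2 | h2 <;>
  rcases lt_or_gt_of_ne hij with h3 | h3 <;>
  first
  | exact absurd (h1.trans h2) h3.not_gt
  | exact absurd (h2.trans h1) h3.not_gt
  | simp only [regular_single, h1, h2, h3, h1.not_gt, h2.not_gt, h3.not_gt, if_true, if_false,
      s_mul_inv_apply, map_add, map_smul, a1, b1, b2, b3, b4, s_castSucc, s_succ, s_mul_s_mul,
      hcomm]
    try module

/-- Linear independence of the `T_w` in the affine algebra: in the extended regular representation
`T_w` sends the vector of `1` to that of `w`, so the coordinates of the image are dual forms. -/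
theorem exists_dual : ∃ a : Equiv.Perm (Fin (m + 1)) → H m →ₗ[R] R,
    ∀ v w, a v (Tw w : H m) = if w = v then 1 else 0 := by
  obtain ⟨f, hf⟩ := exists_evaluation (τ := regular (m := m)) regular_quad regular_braid regular_far
  have key : ∀ w : Equiv.Perm (Fin (m + 1)),
      f (Tw w : H m) (Finsupp.single 1 1) = Finsupp.single w 1 := by
    intro w
    have hL := reducedWord_spec w
    rw [hL.Tw_eq]
    generalize reducedWord w = L at hL
    induction L generalizing w with
    | nil => rw [← hL.1]; simp
    | cons i L ih =>
      obtain ⟨h1, h2⟩ := hL.of_cons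
      rw [List.map_cons, List.prod_cons, Units.val_mul, map_mul, Module.End.mul_apply, ih _ h2]
      change f (T i) _ = _
      rw [hf, regular_single, if_pos, s_mul_s_mul]
      rw [s_mul_inv_apply, s_mul_inv_apply, s_castSucc, s_succ]
      exact h1
  refine ⟨fun v => (Finsupp.lapply v).comp ((LinearMap.applyₗ (Finsupp.single 1 1)).comp
    f.toLinearMap), fun v w => ?_⟩
  simp only [LinearMap.comp_apply, AlgHom.toLinearMap_apply, LinearMap.applyₗ_apply_apply,
    Finsupp.lapply_apply, key, Finsupp.single_apply]

end Regular

/-- The coefficient of `T_v` with respect to a family of linear forms dual to the `T_w`. -/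
def dual (v : Equiv.Perm (Fin (m + 1))) : H m →ₗ[R] R := exists_dual.choose v

theorem dual_Tw (v w : Equiv.Perm (Fin (m + 1))) :
    dual v (Tw w : H m) = if w = v then 1 else 0 := exists_dual.choose_spec v w

/-! ### Parabolic subalgebras and coefficients -/

theorem Tw_mem_parabolic {lam : Fin (m + 1) → ℕ} {w : Equiv.Perm (Fin (m + 1))}
    (hw : w ∈ stab lam) : (Tw w : H m) ∈ parabolic lam :=
  Submodule.subset_span ⟨w, hw, rfl⟩

/-- Consequently `parabolic 0` is the whole finite Hecke algebra `H_n`. -/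
theorem mem_stab_zero (w : Equiv.Perm (Fin (m + 1))) :
    w ∈ stab (0 : Fin (m + 1) → ℕ) := mem_stab.2 fun _ => rfl

theorem parabolic_le_parabolic_zero (lam : Fin (m + 1) → ℕ) : parabolic lam ≤ parabolic 0 :=
  Submodule.span_mono (Set.image_mono fun w _ => mem_stab_zero w)

theorem parabolic_induction {lam : Fin (m + 1) → ℕ} {P : H m → Prop}
    (hT : ∀ w ∈ stab lam, P (Tw w)) (h0 : P 0) (hadd : ∀ x y, P x → P y → P (x + y))
    (hsmul : ∀ (c : R) x, P x → P (c • x)) {x : H m} (hx : x ∈ parabolic lam) : P x := by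
  induction hx using Submodule.span_induction with
  | mem x hx => obtain ⟨w, hw, rfl⟩ := hx; exact hT w hw
  | zero => exact h0
  | add x y _ _ h1 h2 => exact hadd x y h1 h2
  | smul c x _ h => exact hsmul c x h

theorem parabolic_eqOn {lam : Fin (m + 1) → ℕ} {f g : H m →ₗ[R] H m}
    (h : ∀ w ∈ stab lam, f (Tw w) = g (Tw w)) {x : H m} (hx : x ∈ parabolic lam) : f x = g x :=
  parabolic_induction (P := fun x => f x = g x) h (by rw [map_zero, map_zero])
    (fun x y h1 h2 => by rw [map_add, map_add, h1, h2])
    (fun c x h => by rw [map_smul, map_smul, h]) hx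

theorem T_mul_mem_span {i : Fin m} {S : Submodule R (H m)} {w : Equiv.Perm (Fin (m + 1))}
    (h1 : (Tw w : H m) ∈ S) (h2 : (Tw (s i * w) : H m) ∈ S) : T i * (Tw w : H m) ∈ S := by
  rcases lt_or_gt_of_ne (inv_castSucc_ne_inv_succ i w) with h | h
  · rw [T_mul_Tw_of_lt h]; exact h2
  · rw [T_mul_Tw_of_gt h]; exact S.add_mem (S.smul_mem _ h1) (S.smul_mem _ h2)

theorem T_mul_mem_parabolic {lam : Fin (m + 1) → ℕ} {i : Fin m} (hi : s i ∈ stab lam) {x : H m}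
    (hx : x ∈ parabolic lam) : T i * x ∈ parabolic lam :=
  parabolic_induction (P := fun x => T i * x ∈ parabolic lam)
    (fun _ hw => T_mul_mem_span (Tw_mem_parabolic hw) (Tw_mem_parabolic (mul_mem_stab hi hw)))
    (by rw [mul_zero]; exact Submodule.zero_mem _)
    (fun x y h1 h2 => by rw [mul_add]; exact Submodule.add_mem _ h1 h2)
    (fun c x h => by rw [mul_smul_comm]; exact Submodule.smul_mem _ _ h) hx

theorem lead_mul_mem_parabolic_zero (C : Column m) {x : H m} (hx : x ∈ parabolic 0) :
    lead C * x ∈ parabolic 0 := by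
  induction C using column_induction with
  | h0 C h => rwa [lead_of_isHighestColumn h, one_mul]
  | hs C i h₁ h₂ ih =>
    rw [lead_sAct h₁ h₂, mul_assoc, Tbar_mul]
    exact Submodule.add_mem _ (T_mul_mem_parabolic (mem_stab_zero _) ih)
      (Submodule.smul_mem _ _ ih)

/-- The column `w {1, …, l}`. -/
def img (w : Equiv.Perm (Fin (m + 1))) (l : ℕ) : Column m :=
  (Finset.univ.filter fun a : Fin (m + 1) => (a : ℕ) < l).map w.toEmbedding

theorem mem_img {w : Equiv.Perm (Fin (m + 1))} {l : ℕ} {a : Fin (m + 1)} :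
    a ∈ img w l ↔ ((w⁻¹ a : Fin (m + 1)) : ℕ) < l := by
  rw [img, Finset.mem_map_equiv, Finset.mem_filter]
  exact and_iff_right (Finset.mem_univ _)

theorem img_s_mul (i : Fin m) (w : Equiv.Perm (Fin (m + 1))) (l : ℕ) :
    img (s i * w) l = sAct i (img w l) := by
  ext a
  rw [mem_img, mem_sAct, mem_img, s_mul_inv_apply]

theorem card_img (w : Equiv.Perm (Fin (m + 1))) {l : ℕ} (hl : l ≤ m + 1) : (img w l).card = l := by
  rw [img, Finset.card_map, Fin.card_filter_val_lt, min_eq_right hl]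

theorem card_column_le (C : Column m) : C.card ≤ m + 1 := by
  simpa using Finset.card_le_univ C

theorem inv_mul_mem_stab_iff {C : Column m} {w : Equiv.Perm (Fin (m + 1))} :
    (u C)⁻¹ * w ∈ stab (varpi m C.card) ↔ img w C.card = C := by
  rw [mem_stab_varpi, Finset.ext_iff]
  simp only [Equiv.Perm.mul_apply, lt_card_iff, mem_img]
  constructor
  · intro h a
    rw [← h, apply_inv_self]
  · intro h a
    rw [← h]
    change ((w.symm (w a) : Fin (m + 1)) : ℕ) < _ ↔ _
    rw [Equiv.symm_apply_apply]

theorem img_u_mul {C : Column m} {v : Equiv.Perm (Fin (m + 1))}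
    (hv : v ∈ stab (varpi m C.card)) : img (u C * v) C.card = C :=
  inv_mul_mem_stab_iff.1 (by rwa [inv_mul_cancel_left])

/-- The linear map which, on the finite Hecke algebra, takes `x = ∑_E T_{u_E} h_E` to `h_C`. -/
def comp (C : Column m) : H m →ₗ[R] H m :=
  ∑ v ∈ stab (varpi m C.card), (dual (u C * v)).smulRight (Tw v : H m)

theorem comp_mem (C : Column m) (x : H m) : comp C x ∈ parabolic (varpi m C.card) := by
  rw [comp, LinearMap.sum_apply]
  exact Submodule.sum_mem _ fun v hv => Submodule.smul_mem _ _ (Tw_mem_parabolic hv)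

theorem comp_Tw (C : Column m) (w : Equiv.Perm (Fin (m + 1))) :
    comp C (Tw w : H m) = if img w C.card = C then (Tw ((u C)⁻¹ * w) : H m) else 0 := by
  rw [comp, LinearMap.sum_apply]
  simp only [LinearMap.smulRight_apply, dual_Tw, ite_smul, one_smul, zero_smul,
    ← inv_mul_mem_stab_iff, ← inv_mul_eq_iff_eq_mul]
  rw [Finset.sum_ite_eq]

theorem comp_u_mul {C E : Column m} (hE : E.card = C.card) {h : H m}
    (hh : h ∈ parabolic (varpi m C.card)) :
    comp C ((Tw (u E) : H m) * h) = if E = C then h else 0 := by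
  have key : ∀ v ∈ stab (varpi m C.card),
      comp C ((Tw (u E) : H m) * (Tw v : H m)) = if E = C then (Tw v : H m) else 0 := by
    intro v hv
    rw [← hE] at hv
    rw [← Tw_u_mul hv, comp_Tw, ← hE, img_u_mul hv]
    split_ifs with h
    · rw [h, inv_mul_cancel_left]
    · rfl
  refine parabolic_induction (P := fun h => comp C ((Tw (u E) : H m) * h) = if E = C then h else 0)
    key ?_ ?_ ?_ hh
  · simp
  · intro x y h1 h2
    rw [mul_add, map_add, h1, h2]; split_ifs <;> simp
  · intro c x h1
    rw [mul_smul_comm, map_smul, h1]; split_ifs <;> simp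

theorem sum_u_mul_comp {l : ℕ} (hl : l ≤ m + 1) {x : H m} (hx : x ∈ parabolic 0) :
    x = ∑ E ∈ Finset.powersetCard l Finset.univ, (Tw (u E) : H m) * comp E x := by
  have := parabolic_eqOn (f := LinearMap.id)
    (g := ∑ E ∈ Finset.powersetCard l Finset.univ,
      (LinearMap.mulLeft R (Tw (u E) : H m)).comp (comp E)) (fun w _ => ?_) hx
  · simpa using this
  · simp only [LinearMap.id_apply, LinearMap.sum_apply, LinearMap.comp_apply,
      LinearMap.mulLeft_apply]
    rw [Finset.sum_eq_single (img w l)]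
    · have e : img w (img w l).card = img w l := by rw [card_img w hl]
      rw [comp_Tw, if_pos e, ← Tw_u_mul (inv_mul_mem_stab_iff.2 e), mul_inv_cancel_left]
    · intro E hE hne
      rw [Finset.mem_powersetCard] at hE
      rw [comp_Tw, hE.2, if_neg hne.symm, mul_zero]
    · intro h
      exact absurd (Finset.mem_powersetCard.2 ⟨Finset.subset_univ _, card_img w hl⟩) h

/-- `comp C` reads off `h C` from any decomposition, in particular from the one chosen in `coeff`.
-/
theorem coeff_eq_comp (C : Column m) {x : H m} (hx : x ∈ parabolic 0) : coeff C x = comp C x := by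
  have hex : ∃ h, IsDecomp C.card x h := by
    -- `IsDecomp` constrains `h E` for columns `E` of every length, hence the value `0` off length
    -- `C.card`.
    refine ⟨fun E => if E.card = C.card then comp E x else 0, fun E => ?_, ?_⟩
    · dsimp only
      split_ifs with h
      · rw [← h]; exact comp_mem E x
      · exact Submodule.zero_mem _
    · conv_lhs => rw [sum_u_mul_comp (card_column_le C) hx]
      refine Finset.sum_congr rfl fun E hE => ?_
      dsimp only
      rw [if_pos (Finset.mem_powersetCard.1 hE).2]
  rw [coeff, dif_pos hex]
  have hspec := hex.choose_spec
  conv_rhs => rw [hspec.2]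
  rw [map_sum, Finset.sum_eq_single C]
  · rw [comp_u_mul rfl (hspec.1 C), if_pos rfl]
  · intro E hE hne
    rw [comp_u_mul (Finset.mem_powersetCard.1 hE).2 (hspec.1 E), if_neg hne]
  · intro h
    exact absurd (Finset.mem_powersetCard.2 ⟨Finset.subset_univ _, rfl⟩) h

/-- The map `Ψ_S ↦ Ψ_{C ⊗ S}`. -/
def addColumn (C : Column m) : H m →ₗ[R] H m := (LinearMap.mulLeft R (lead C)).comp (comp C)

theorem addColumn_apply (C : Column m) (x : H m) : addColumn C x = lead C * comp C x := rfl

theorem addColumn_mem (C : Column m) (x : H m) : addColumn C x ∈ parabolic 0 :=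
  lead_mul_mem_parabolic_zero C (parabolic_le_parabolic_zero _ (comp_mem C x))

/-! ### Stabilizers of dominant weights and the linear recursion for `Psi`. -/

theorem varpi_antitone (l : ℕ) : Antitone (varpi m l) := by
  intro a b hab
  unfold varpi
  rw [Fin.le_def] at hab
  split_ifs <;> omega

/-- Between `a` and `w a` both weights change in the same direction, so the sum is unchanged only if
each is. -/
theorem mem_stab_add {lam mu : Fin (m + 1) → ℕ} (hlam : Antitone lam) (hmu : Antitone mu)
    {w : Equiv.Perm (Fin (m + 1))} : w ∈ stab (lam + mu) ↔ w ∈ stab lam ∧ w ∈ stab mu := by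
  simp only [mem_stab, ← forall_and, Pi.add_apply]
  refine forall_congr' fun a => ⟨fun h => ?_, fun h => by rw [h.1, h.2]⟩
  rcases le_total (w a) a with hle | hle
  · have := hlam hle; have := hmu hle; omega
  · have := hlam hle; have := hmu hle; omega

/-- Left translation by `(u C)⁻¹` matches the `w` in the stabilizer of `lam` with `w {1, …, l} = C`
with the intersection of the two stabilizers. Besides highest weight columns, the case `lam = 0`
with arbitrary `C` is needed for the empty filling. -/
theorem comp_oneElt {lam : Fin (m + 1) → ℕ} (hlam : Antitone lam) {C : Column m}
    (hC : u C ∈ stab lam) : comp C (oneElt lam) = oneElt (varpi m C.card + lam) := by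
  rw [oneElt, map_sum, oneElt]
  simp only [comp_Tw]
  rw [← Finset.sum_filter]
  refine Finset.sum_nbij' (fun w => (u C)⁻¹ * w) (fun w => u C * w) ?_ ?_ ?_ ?_ ?_
  · intro w hw
    rw [Finset.mem_filter] at hw
    refine (mem_stab_add (varpi_antitone _) hlam).2 ⟨inv_mul_mem_stab_iff.2 hw.2, ?_⟩
    have hw1 := hw.1
    rw [mem_stab] at *
    intro a
    rw [← hw1 a, Equiv.Perm.mul_apply, ← hC, apply_inv_self]
  · intro w hw
    rw [mem_stab_add (varpi_antitone _) hlam] at hw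
    exact Finset.mem_filter.2 ⟨mul_mem_stab hC hw.2, img_u_mul hw.1⟩
  · intro w _; exact mul_inv_cancel_left _ _
  · intro w _; exact inv_mul_cancel_left _ _
  · intro w _; rfl

/-- The two claims are proved together because `coeff` is known to agree with `comp` only on `H_n`.
-/
theorem Psi_mem_and_cons (S : List (Column m)) :
    Psi S ∈ parabolic 0 ∧ ∀ C : Column m, Psi (C :: S) = addColumn C (Psi S) := by
  induction S with
  | nil =>
    refine ⟨Submodule.sum_mem _ fun w hw => Tw_mem_parabolic hw, fun C => ?_⟩
    have := comp_oneElt (lam := 0) (fun _ _ _ => le_rfl) (mem_stab_zero (u C))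
    rw [addColumn_apply, Psi, Psi, this, add_zero]
  | cons D S ih =>
    have hmem : Psi (D :: S) ∈ parabolic 0 := by
      rw [ih.2]; exact addColumn_mem _ _
    refine ⟨hmem, fun C => ?_⟩
    rw [Psi, coeff_eq_comp C hmem, addColumn_apply]

theorem Psi_mem (S : List (Column m)) : Psi S ∈ parabolic 0 := (Psi_mem_and_cons S).1

theorem Psi_cons (C : Column m) (S : List (Column m)) : Psi (C :: S) = addColumn C (Psi S) :=
  (Psi_mem_and_cons S).2 C

/-! ### Highest weight tableaux -/

theorem shape_cons (C : Column m) (S : List (Column m)) :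
    shape (C :: S) = varpi m C.card + shape S := by
  rw [shape, List.map_cons, List.sum_cons, shape]

theorem shape_antitone (S : List (Column m)) : Antitone (shape S) := by
  induction S with
  | nil => exact fun _ _ _ => le_rfl
  | cons C S ih => rw [shape_cons]; exact (varpi_antitone _).add ih

theorem Psi_of_isHighestWeight {S : List (Column m)} (h : IsHighestWeight S) :
    Psi S = oneElt (shape S) := by
  induction S with
  | nil => rfl
  | cons C S ih =>
    have hC : IsHighestColumn C := h C List.mem_cons_self
    rw [Psi_cons, ih fun E hE => h E (List.mem_cons_of_mem _ hE), addColumn_apply,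
      lead_of_isHighestColumn hC, one_mul, comp_oneElt (shape_antitone S), shape_cons]
    rw [u_of_isHighestColumn hC]
    exact one_mem_stab _

theorem isHighestColumn_filter {μ : Fin (m + 1) → ℕ} (hμ : Antitone μ) (c : ℕ) :
    IsHighestColumn (Finset.univ.filter fun i => c < μ i) :=
  isHighestColumn_of_isLowerSet fun _ _ hba ha =>
    Finset.mem_filter.2 ⟨Finset.mem_univ _, (Finset.mem_filter.1 ha).2.trans_le (hμ hba)⟩

theorem IsHighestColumn.mem_iff {C : Column m} (h : IsHighestColumn C) {a : Fin (m + 1)} :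
    a ∈ C ↔ (a : ℕ) < C.card := by
  conv_lhs => rw [h]
  simp

theorem isHighestWeight_highestTableau {μ : Fin (m + 1) → ℕ} (hμ : Antitone μ) :
    IsHighestWeight (highestTableau μ) := by
  intro C hC
  obtain ⟨c, -, rfl⟩ := List.mem_map.1 hC
  exact isHighestColumn_filter hμ c

theorem shape_highestTableau {μ : Fin (m + 1) → ℕ} (hμ : Antitone μ) :
    shape (highestTableau μ) = μ := by
  have key : ∀ (N : ℕ), (((List.range N).map fun c => Finset.univ.filter fun i => c < μ i).map
      fun C : Column m => varpi m C.card).sum = fun a => min N (μ a) := by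
    intro N
    induction N with
    | zero => ext a; simp
    | succ N ih =>
      rw [List.range_succ, List.map_append, List.map_append, List.sum_append, ih]
      ext a
      have h := (isHighestColumn_filter hμ N).mem_iff (a := a)
      rw [Finset.mem_filter, and_iff_right (Finset.mem_univ _)] at h
      simp only [List.map_cons, List.map_nil, List.sum_singleton, Pi.add_apply, varpi, ← h]
      split_ifs <;> omega
  rw [shape, highestTableau, key]
  ext a
  exact min_eq_right (hμ (Fin.zero_le a))

/-- The stabilizer splits into pairs `{w, s j * w}`, and each `T_w + T_{s_j w}` is an eigenvector of
`T_j` with eigenvalue `t`. -/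
theorem T_mul_oneElt {lam : Fin (m + 1) → ℕ} {j : Fin m} (hj : lam j.castSucc = lam j.succ) :
    T j * (oneElt lam : H m) = t • oneElt lam := by
  have hs := s_mem_stab hj
  let p : Equiv.Perm (Fin (m + 1)) → Prop := fun w => w⁻¹ j.castSucc < w⁻¹ j.succ
  have hsum : (oneElt lam : H m) =
      ∑ w ∈ (stab lam).filter p, ((Tw w : H m) + (Tw (s j * w) : H m)) := by
    rw [oneElt, ← Finset.sum_filter_add_sum_filter_not _ p, Finset.sum_add_distrib]
    congr 1
    refine Finset.sum_nbij' (fun w => s j * w) (fun w => s j * w) ?_ ?_ ?_ ?_ ?_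
    · intro w hw
      rw [Finset.mem_filter] at *
      refine ⟨mul_mem_stab hs hw.1, ?_⟩
      have := hw.2
      simp only [p, s_mul_inv_apply, s_castSucc, s_succ, not_lt] at *
      exact this.lt_of_ne (inv_castSucc_ne_inv_succ j w).symm
    · intro w hw
      rw [Finset.mem_filter] at *
      refine ⟨mul_mem_stab hs hw.1, ?_⟩
      have := hw.2
      simp only [p, s_mul_inv_apply, s_castSucc, s_succ, not_lt] at *
      exact this.le
    · intro w _; exact s_mul_s_mul _ _
    · intro w _; exact s_mul_s_mul _ _
    · intro w _; rw [s_mul_s_mul]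
  rw [hsum, Finset.mul_sum, Finset.smul_sum]
  refine Finset.sum_congr rfl fun w hw => ?_
  have hw := (Finset.mem_filter.1 hw).2
  rw [mul_add, T_mul_Tw_of_lt hw, T_mul_Tw_of_gt, s_mul_s_mul]
  · module
  · simpa only [s_mul_inv_apply, s_castSucc, s_succ] using hw

/-! ### Vanishing on fillings that are not semistandard -/

/-- The number of entries of `C` among the first `k` elements of `[n]`. -/
def cnt (C : Column m) (k : ℕ) : ℕ := (C.filter fun a : Fin (m + 1) => (a : ℕ) < k).card

theorem cnt_mono_left {C D : Column m} (h : C ⊆ D) (k : ℕ) : cnt C k ≤ cnt D k :=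
  Finset.card_le_card (Finset.filter_subset_filter _ h)

theorem cnt_mono_right (C : Column m) {k l : ℕ} (h : k ≤ l) : cnt C k ≤ cnt C l :=
  Finset.card_le_card (Finset.monotone_filter_right _ fun _ _ ha => lt_of_lt_of_le ha h)

theorem s_lt_iff {i : Fin m} {k : ℕ} (hk : k ≠ i + 1) (a : Fin (m + 1)) :
    ((s i a : Fin (m + 1)) : ℕ) < k ↔ (a : ℕ) < k := by
  by_cases h1 : a = i.castSucc
  · rw [h1, s_castSucc, Fin.val_castSucc, Fin.val_succ]; omega
  by_cases h2 : a = i.succ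
  · rw [h2, s_succ, Fin.val_castSucc, Fin.val_succ]; omega
  rw [s_of_ne i h1 h2]

theorem cnt_sAct {i : Fin m} {k : ℕ} (hk : k ≠ i + 1) (C : Column m) :
    cnt (sAct i C) k = cnt C k := by
  rw [cnt, sAct, Finset.filter_map, Finset.card_map, cnt]
  congr 1
  exact Finset.filter_congr fun a _ => s_lt_iff hk a

theorem cnt_succ_of_notMem {i : Fin m} {C : Column m} (h : i.castSucc ∉ C) :
    cnt C (i + 1) = cnt C i := by
  rw [cnt, cnt]
  congr 1
  refine Finset.filter_congr fun a ha => ?_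
  have : (a : ℕ) ≠ i := fun e => h (by rwa [show i.castSucc = a from Fin.ext e.symm])
  omega

/-- The span of the `T_w` such that `w {1, …, l}` is at most `C` entrywise, `l` being the length of
`C`. -/
def below (C : Column m) : Submodule R (H m) :=
  Submodule.span R
    ((fun w => (Tw w : H m)) '' {w : Equiv.Perm (Fin (m + 1)) | ∀ k, cnt C k ≤ cnt (img w C.card) k})

/-- Only `T_w` and `T_{s_i w}` occur in the product. The counts of `C` and `sAct i C` can differ
only at `k = i + 1`, where that of `sAct i C` equals `cnt C i`; this leaves room for either `w` or
`s i * w`. -/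
theorem Tbar_mul_mem_below {i : Fin m} {C : Column m} (h₂ : i.succ ∉ C) {x : H m}
    (hx : x ∈ below C) : Tbar i * x ∈ below (sAct i C) := by
  have hn : i.castSucc ∉ sAct i C := by rwa [mem_sAct, s_castSucc]
  induction hx using Submodule.span_induction with
  | zero => rw [mul_zero]; exact Submodule.zero_mem _
  | add x y _ _ h1 h2 => rw [mul_add]; exact Submodule.add_mem _ h1 h2
  | smul c x _ h => rw [mul_smul_comm]; exact Submodule.smul_mem _ _ h
  | mem x hx =>
    obtain ⟨w, hw, rfl⟩ := hx
    rw [Set.mem_ofPred_eq] at hw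
    have h1 : (Tw w : H m) ∈ below (sAct i C) := by
      refine Submodule.subset_span ⟨w, fun k => ?_, rfl⟩
      rw [card_sAct]
      by_cases hk : k = i + 1
      · rw [hk, cnt_succ_of_notMem hn, cnt_sAct (by omega)]
        exact (hw i).trans (cnt_mono_right _ (by omega))
      · rw [cnt_sAct hk]
        exact hw k
    have h2 : (Tw (s i * w) : H m) ∈ below (sAct i C) := by
      refine Submodule.subset_span ⟨s i * w, fun k => ?_, rfl⟩
      rw [card_sAct, img_s_mul]
      by_cases hk : k = i + 1
      · rw [hk, cnt_succ_of_notMem hn, cnt_sAct (by omega)]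
        refine (hw i).trans ?_
        rw [← cnt_sAct (i := i) (by omega)]
        exact cnt_mono_right _ (by omega)
      · rw [cnt_sAct hk, cnt_sAct hk]
        exact hw k
    rw [Tbar_mul]
    exact Submodule.add_mem _ (T_mul_mem_span h1 h2) (Submodule.smul_mem _ _ h1)

theorem lead_mul_mem_below (C : Column m) {h : H m} (hh : h ∈ parabolic (varpi m C.card)) :
    lead C * h ∈ below C := by
  induction C using column_induction with
  | h0 C hC =>
    rw [lead_of_isHighestColumn hC, one_mul]
    refine Submodule.span_mono (Set.image_mono fun v hv k => ?_) hh
    have := img_u_mul hv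
    rw [u_of_isHighestColumn hC, one_mul] at this
    rw [this]
  | hs C i h₁ h₂ ih =>
    rw [card_sAct] at hh
    rw [lead_sAct h₁ h₂, mul_assoc]
    exact Tbar_mul_mem_below h₂ (ih hh)

theorem addColumn_mem_below (C : Column m) (x : H m) : addColumn C x ∈ below C :=
  lead_mul_mem_below C (comp_mem C x)

/-- If `T_w` contributes to `comp C`, then `w` maps the first `C.card` positions onto `C`. Its first
`D.card` values then lie in `C`, so `C` has at least as many small entries as `D`. -/
theorem comp_eq_zero {C D : Column m} (hcard : D.card ≤ C.card)
    (hne : ¬ ∀ k, cnt D k ≤ cnt C k) {x : H m} (hx : x ∈ below D) : comp C x = 0 := by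
  induction hx using Submodule.span_induction with
  | zero => rw [map_zero]
  | add x y _ _ h1 h2 => rw [map_add, h1, h2, add_zero]
  | smul c x _ h => rw [map_smul, h, smul_zero]
  | mem x hx =>
    obtain ⟨w, hw, rfl⟩ := hx
    rw [comp_Tw, if_neg]
    intro e
    refine hne fun k => (hw k).trans (cnt_mono_left ?_ k)
    intro a ha
    rw [← e, mem_img]
    exact (mem_img.1 ha).trans_le hcard

/-! ### From counting functions to entries in rows. -/

theorem card_filter_lt_orderEmbOfFin (C : Column m) {i : ℕ} (h : i < C.card) :
    (C.filter fun a => a < C.orderEmbOfFin rfl ⟨i, h⟩).card = i := by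
  have : (C.filter fun a => a < C.orderEmbOfFin rfl ⟨i, h⟩) =
      (Finset.Iio (⟨i, h⟩ : Fin C.card)).map (C.orderEmbOfFin rfl).toEmbedding := by
    ext a
    simp only [Finset.mem_filter, Finset.mem_map, Finset.mem_Iio, RelEmbedding.coe_toEmbedding]
    constructor
    · rintro ⟨ha, hlt⟩
      rw [← Finset.mem_coe, ← Finset.range_orderEmbOfFin C rfl] at ha
      obtain ⟨b, rfl⟩ := ha
      exact ⟨b, by simpa using hlt, rfl⟩
    · rintro ⟨b, hb, rfl⟩
      exact ⟨Finset.orderEmbOfFin_mem _ _ _, by simpa using hb⟩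
  rw [this, Finset.card_map, Fin.card_Iio]

theorem le_orderEmbOfFin (C : Column m) {i : ℕ} (h : i < C.card) :
    i ≤ C.orderEmbOfFin rfl ⟨i, h⟩ := by
  conv_lhs => rw [← card_filter_lt_orderEmbOfFin C h]
  refine (Finset.card_le_card (t := Finset.Iio (C.orderEmbOfFin rfl ⟨i, h⟩)) fun a ha => ?_).trans ?_
  · exact Finset.mem_Iio.2 (Finset.mem_filter.1 ha).2
  · rw [Fin.card_Iio]

theorem orderEmbOfFin_le_of_cnt_le {C D : Column m} (h : ∀ k, cnt D k ≤ cnt C k) (i : ℕ)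
    (hC : i < C.card) (hD : i < D.card) :
    C.orderEmbOfFin rfl ⟨i, hC⟩ ≤ D.orderEmbOfFin rfl ⟨i, hD⟩ := by
  by_contra! hlt
  have h1 := card_filter_lt_orderEmbOfFin C hC
  have h2 := card_filter_lt_orderEmbOfFin D hD
  have hm := Finset.orderEmbOfFin_mem D rfl ⟨i, hD⟩
  generalize D.orderEmbOfFin rfl ⟨i, hD⟩ = p at *
  generalize C.orderEmbOfFin rfl ⟨i, hC⟩ = q at *
  -- Counting just past the entry `p` of `D` in row `i`: `D` already has `i + 1` entries there, `C`
  -- at most `i`.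
  have e1 : cnt C (p + 1) ≤ i := by
    rw [← h1]
    refine Finset.card_le_card (Finset.monotone_filter_right _ fun a _ ha => ?_)
    rw [Fin.lt_def] at *
    omega
  have e2 : i + 1 ≤ cnt D (p + 1) := by
    conv_lhs => rw [← h2]
    rw [← Finset.card_insert_of_notMem (a := p) (by simp)]
    refine Finset.card_le_card fun a ha => ?_
    rw [Finset.mem_insert, Finset.mem_filter] at ha
    rw [Finset.mem_filter]
    rcases ha with rfl | ⟨ha, hap⟩
    · exact ⟨hm, Nat.lt_succ_self _⟩
    · exact ⟨ha, Nat.lt_succ_of_lt hap⟩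
  have := h (p + 1)
  omega

theorem Psi_eq_zero {S : List (Column m)} (hS : IsTensor S) (h : ¬ IsSemistandard S) :
    Psi S = 0 := by
  induction S with
  | nil => exact absurd List.Pairwise.nil h
  | cons C S ih =>
    have hSt : IsTensor S :=
      ⟨fun E hE => hS.1 E (List.mem_cons_of_mem _ hE), (List.pairwise_cons.1 hS.2).2⟩
    rw [Psi_cons]
    by_cases hss : IsSemistandard S
    · match S, hS, h, hSt, hss with
      | [], _, h, _, _ => exact absurd (List.pairwise_singleton _ _) h
      | D :: S, hS, h, hSt, hss =>
        -- As `D :: S` is semistandard, failure must already occur between `C` and `D`: column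
        -- lengths decrease weakly, so a row reaching a later column also meets `D`, and
        -- transitivity applies.
        rw [Psi_cons, addColumn_apply, comp_eq_zero _ _ (addColumn_mem_below D _), mul_zero]
        · exact (List.pairwise_cons.1 hS.2).1 D List.mem_cons_self
        · intro hle
          refine h (List.pairwise_cons.2 ⟨fun E hE i hC hE' => ?_, hss⟩)
          rcases List.mem_cons.1 hE with rfl | hE
          · exact orderEmbOfFin_le_of_cnt_le hle i hC hE'
          · have hD : i < D.card := hE'.trans_le ((List.pairwise_cons.1 hSt.2).1 E hE)
            exact (orderEmbOfFin_le_of_cnt_le hle i hC hD).trans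
              ((List.pairwise_cons.1 hss).1 E hE i hD hE')
    · rw [ih hSt hss, map_zero]

/-! ### Commutation of generators with the addition of a column -/

theorem comp_T_mul_of_iff {j i : Fin m} {E : Column m} (h : j.castSucc ∈ E ↔ j.succ ∈ E)
    (hi : s i ∈ stab (varpi m E.card)) (hT : T j * (Tw (u E) : H m) = Tw (u E) * T i)
    {y : H m} (hy : y ∈ parabolic 0) : comp E (T j * y) = T i * comp E y := by
  refine parabolic_eqOn (f := (comp E).comp (LinearMap.mulLeft R (T j)))
    (g := (LinearMap.mulLeft R (T i)).comp (comp E)) (fun w _ => ?_) hy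
  simp only [LinearMap.comp_apply, LinearMap.mulLeft_apply]
  by_cases hw : img w E.card = E
  · have hv := inv_mul_mem_stab_iff.2 hw
    have e : (Tw w : H m) = Tw (u E) * Tw ((u E)⁻¹ * w) := by
      rw [← Tw_u_mul hv, mul_inv_cancel_left]
    rw [comp_Tw, if_pos hw, e, ← mul_assoc, hT, mul_assoc, comp_u_mul rfl, if_pos rfl]
    exact T_mul_mem_parabolic hi (Tw_mem_parabolic hv)
  · have h1 : comp E (Tw w : H m) = 0 := by rw [comp_Tw, if_neg hw]
    have h2 : comp E (Tw (s j * w) : H m) = 0 := by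
      rw [comp_Tw, if_neg]
      rw [img_s_mul]
      intro e
      apply hw
      rw [← sAct_sAct j (img w _), e, sAct_eq_self h]
    rw [h1, mul_zero]
    exact T_mul_mem_span (S := LinearMap.ker (comp E)) h1 h2

theorem comp_Tw_s_mul {j : Fin m} {E : Column m} (hu : u (sAct j E) = s j * u E)
    (w : Equiv.Perm (Fin (m + 1))) :
    comp E (Tw (s j * w) : H m) = comp (sAct j E) (Tw w : H m) := by
  rw [comp_Tw, comp_Tw, hu, card_sAct, img_s_mul, mul_inv_rev, s_inv, mul_assoc]
  congr 1
  rw [eq_iff_iff]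
  constructor
  · intro h; rw [← h, sAct_sAct]
    rw [h]
  · intro h; rw [h, sAct_sAct]

theorem u_sAct' {i : Fin m} {C : Column m} (h₁ : i.castSucc ∉ C) (h₂ : i.succ ∈ C) :
    u (sAct i C) = s i * u C := by
  have := u_sAct (i := i) (C := sAct i C) (by rwa [mem_sAct, s_castSucc])
    (by rwa [mem_sAct, s_succ])
  rw [sAct_sAct] at this
  rw [this, s_mul_s_mul]

theorem comp_Tw_of_gt {j : Fin m} {E : Column m} (h₁ : j.castSucc ∈ E) (h₂ : j.succ ∉ E)
    {w : Equiv.Perm (Fin (m + 1))} (hw : w⁻¹ j.succ < w⁻¹ j.castSucc) :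
    comp E (Tw w : H m) = 0 := by
  rw [comp_Tw, if_neg]
  intro e
  rw [← e, mem_img] at h₁ h₂
  rw [Fin.lt_def] at hw
  omega

theorem comp_Tw_of_lt {j : Fin m} {E : Column m} (h₁ : j.castSucc ∉ E) (h₂ : j.succ ∈ E)
    {w : Equiv.Perm (Fin (m + 1))} (hw : w⁻¹ j.castSucc < w⁻¹ j.succ) :
    comp E (Tw w : H m) = 0 := by
  rw [comp_Tw, if_neg]
  intro e
  rw [← e, mem_img] at h₁ h₂
  rw [Fin.lt_def] at hw
  omega

/-- If `w {1, …, l} = E` then `j` stands before `j + 1` in `w`. Hence only the term `t T_{s_j w}`,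
arising when `j + 1` stands before `j`, can contribute to the coset of `E`. -/
theorem comp_T_mul_of_mem {j : Fin m} {E : Column m} (h₁ : j.castSucc ∈ E) (h₂ : j.succ ∉ E)
    {y : H m} (hy : y ∈ parabolic 0) : comp E (T j * y) = t • comp (sAct j E) y := by
  refine parabolic_eqOn (f := (comp E).comp (LinearMap.mulLeft R (T j)))
    (g := t • comp (sAct j E)) (fun w _ => ?_) hy
  simp only [LinearMap.comp_apply, LinearMap.mulLeft_apply, LinearMap.smul_apply]
  rw [← comp_Tw_s_mul (u_sAct h₁ h₂)]
  rcases lt_or_gt_of_ne (inv_castSucc_ne_inv_succ j w) with h | h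
  · have h0 : comp E (Tw (s j * w) : H m) = 0 := comp_Tw_of_gt h₁ h₂
      (by rwa [s_mul_inv_apply, s_mul_inv_apply, s_castSucc, s_succ])
    rw [T_mul_Tw_of_lt h, h0, smul_zero]
  · rw [T_mul_Tw_of_gt h, map_add, map_smul, map_smul, comp_Tw_of_gt h₁ h₂ h, smul_zero, zero_add]

theorem comp_T_mul_of_notMem {j : Fin m} {E : Column m} (h₁ : j.castSucc ∉ E) (h₂ : j.succ ∈ E)
    {y : H m} (hy : y ∈ parabolic 0) :
    comp E (T j * y) = comp (sAct j E) y + (t - 1) • comp E y := by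
  refine parabolic_eqOn (f := (comp E).comp (LinearMap.mulLeft R (T j)))
    (g := comp (sAct j E) + (t - 1) • comp E) (fun w _ => ?_) hy
  simp only [LinearMap.comp_apply, LinearMap.mulLeft_apply, LinearMap.smul_apply,
    LinearMap.add_apply]
  rw [← comp_Tw_s_mul (u_sAct' h₁ h₂)]
  rcases lt_or_gt_of_ne (inv_castSucc_ne_inv_succ j w) with h | h
  · rw [T_mul_Tw_of_lt h, comp_Tw_of_lt h₁ h₂ h, smul_zero, add_zero]
  · have h0 : comp E (Tw (s j * w) : H m) = 0 := comp_Tw_of_lt h₁ h₂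
      (by rwa [s_mul_inv_apply, s_mul_inv_apply, s_castSucc, s_succ])
    rw [T_mul_Tw_of_gt h, map_add, map_smul, map_smul, h0, smul_zero, zero_add, add_zero]

theorem addColumn_T_mul_of_iff {j : Fin m} {E : Column m} (h : j.castSucc ∈ E ↔ j.succ ∈ E)
    {y : H m} (hy : y ∈ parabolic 0) : addColumn E (T j * y) = T j * addColumn E y := by
  obtain ⟨i, hi, h1, h2⟩ := exists_T_mul_eq h
  rw [addColumn_apply, addColumn_apply, comp_T_mul_of_iff h hi h1 hy, ← mul_assoc, ← mul_assoc, h2]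

/-- The factor `t` from `comp` is absorbed by `T_j * (t T_j⁻¹) = t`, since `lead (sAct j E)` is `t
T_j⁻¹` times `lead E`. -/
theorem addColumn_T_mul_of_mem {j : Fin m} {E : Column m} (h₁ : j.castSucc ∈ E)
    (h₂ : j.succ ∉ E) {y : H m} (hy : y ∈ parabolic 0) :
    addColumn E (T j * y) = T j * addColumn (sAct j E) y := by
  rw [addColumn_apply, addColumn_apply, comp_T_mul_of_mem h₁ h₂ hy, lead_sAct h₁ h₂, mul_assoc,
    ← mul_assoc (T j), T_mul_Tbar, smul_mul_assoc, one_mul, mul_smul_comm]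

theorem addColumn_T_mul_of_notMem {j : Fin m} {E : Column m} (h₁ : j.castSucc ∉ E)
    (h₂ : j.succ ∈ E) {y : H m} (hy : y ∈ parabolic 0) :
    addColumn E (T j * y) = Tbar j * addColumn (sAct j E) y + (t - 1) • addColumn E y := by
  have hlead := lead_sAct (i := j) (C := sAct j E) (by rwa [mem_sAct, s_castSucc])
    (by rwa [mem_sAct, s_succ])
  rw [sAct_sAct] at hlead
  rw [addColumn_apply, addColumn_apply, addColumn_apply, comp_T_mul_of_notMem h₁ h₂ hy, mul_add,
    mul_smul_comm, ← mul_assoc, ← hlead]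

theorem addColumn_Tbar_mul (j : Fin m) (E : Column m) (y : H m) :
    addColumn E (Tbar j * y) = addColumn E (T j * y) + (1 - t) • addColumn E y := by
  rw [Tbar_mul, map_add, map_smul]

/-! ### The exchange relation -/

theorem tensor_congr {C D : ℕ → Column m} {r : ℕ} (h : ∀ i ≤ r, C i = D i) :
    tensor C r = tensor D r := by
  induction r with
  | zero => rfl
  | succ r ih =>
    rw [tensor, tensor, h _ le_rfl, ih fun i hi => h i (hi.trans (Nat.le_succ r))]

theorem tensor_Omega_of_le {j : Fin m} {k r : ℕ} (h : k ≤ r) (C : ℕ → Column m) :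
    tensor (Omega j k C) (r + 1) = C (r + 1) :: tensor (Omega j k C) r := by
  rw [tensor, Omega, if_neg (by omega)]

theorem tensor_Omega_self (j : Fin m) (r : ℕ) (C : ℕ → Column m) :
    tensor (Omega j (r + 1) C) (r + 1) = sAct j (C (r + 1)) :: tensor (Omega j r C) r := by
  rw [tensor, tensor_congr (C := Omega j (r + 1) C) (D := Omega j r C) (r := r)]
  · rw [Omega, if_pos le_rfl]
  · intro i hi
    rw [Omega, Omega, if_pos hi, if_pos (by omega)]

/-- All that matters about the tail `S` is that `T_j` acts on its element by `t`. The operator in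
front is `T_j` or `t T_j⁻¹` according to the sign of the last column added; a new column of the same
sign keeps it, while one of opposite sign changes it at the cost of the term `k = r`. -/
theorem Psi_exchange {j : Fin m} {S : List (Column m)} (hS : T j * Psi S = t • Psi S)
    {C : ℕ → Column m} (h₁ : j.castSucc ∉ C 1) (h₂ : j.succ ∈ C 1) {r : ℕ} (hr : 1 ≤ r) :
    Psi (tensor C r ++ S) =
      (if j.castSucc ∈ C r ∧ j.succ ∉ C r then T j else Tbar j) *
        Psi (tensor (Omega j r C) r ++ S) +
      ∑ k ∈ (Finset.Ico 1 r).filter (fun k => sgn j (C k) * sgn j (C (k + 1)) = -1),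
        ((sgn j (C k) : R) * (1 - t)) • Psi (tensor (Omega j k C) r ++ S) := by
  induction r, hr using Nat.le_induction with
  | base =>
    have e1 : tensor C 1 ++ S = C 1 :: S := rfl
    have e2 : tensor (Omega j 1 C) 1 ++ S = sAct j (C 1) :: S := rfl
    -- Inserting `t T_j⁻¹`, which fixes `Psi S`, starts the process; the two multiples of `addColumn
    -- (C 1) (Psi S)` then cancel.
    have h0 : Psi S = Tbar j * Psi S := by rw [Tbar_mul, hS]; module
    rw [Finset.Ico_self, Finset.filter_empty, Finset.sum_empty, add_zero, if_neg (fun h => h₁ h.1),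
      e1, e2, Psi_cons, Psi_cons]
    conv_lhs => rw [h0]
    rw [addColumn_Tbar_mul, addColumn_T_mul_of_notMem h₁ h₂ (Psi_mem S)]
    module
  | succ r hr ih =>
    have e1 : tensor C (r + 1) ++ S = C (r + 1) :: (tensor C r ++ S) := rfl
    have e3 : ∀ k ∈ Finset.Ico 1 r, Psi (tensor (Omega j k C) (r + 1) ++ S) =
        addColumn (C (r + 1)) (Psi (tensor (Omega j k C) r ++ S)) := fun k hk => by
      rw [tensor_Omega_of_le (Finset.mem_Ico.1 hk).2.le, List.cons_append, Psi_cons]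
    have hsum : addColumn (C (r + 1))
        (∑ k ∈ (Finset.Ico 1 r).filter (fun k => sgn j (C k) * sgn j (C (k + 1)) = -1),
          ((sgn j (C k) : R) * (1 - t)) • Psi (tensor (Omega j k C) r ++ S)) =
        ∑ k ∈ (Finset.Ico 1 r).filter (fun k => sgn j (C k) * sgn j (C (k + 1)) = -1),
          ((sgn j (C k) : R) * (1 - t)) • Psi (tensor (Omega j k C) (r + 1) ++ S) := by
      rw [map_sum]
      refine Finset.sum_congr rfl fun k hk => ?_
      rw [map_smul, e3 k (Finset.mem_filter.1 hk).1]
    rw [e1, Psi_cons, ih, map_add, hsum, Finset.sum_filter, Finset.sum_filter,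
      Finset.sum_Ico_succ_top hr, ← add_assoc, add_right_comm]
    congr 1
    rw [tensor_Omega_self, tensor_Omega_of_le le_rfl, List.cons_append, List.cons_append, Psi_cons,
      Psi_cons]
    -- The terms with `k < r` have been matched. The rest is an identity in `y`, `D = C r` and `E =
    -- C (r + 1)`, checked by the sign of `D` and the membership of `j`, `j + 1` in `E`.
    have hy := Psi_mem (tensor (Omega j r C) r ++ S)
    generalize Psi (tensor (Omega j r C) r ++ S) = y at hy
    generalize C (r + 1) = E
    generalize C r = D
    by_cases hD : j.castSucc ∈ D ∧ j.succ ∉ D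
    · have sD : sgn j D = -1 := if_pos hD
      rw [if_pos hD, sD]
      by_cases hE : j.castSucc ∈ E
      · by_cases hE' : j.succ ∈ E
        · have sE : sgn j E = 1 := if_neg fun h => h.2 hE'
          rw [addColumn_T_mul_of_iff (iff_of_true hE hE') hy, sE, if_neg fun h => h.2 hE',
            sAct_eq_self (iff_of_true hE hE'), Tbar_mul, if_pos (by norm_num)]
          push_cast
          module
        · have sE : sgn j E = -1 := if_pos ⟨hE, hE'⟩
          rw [addColumn_T_mul_of_mem hE hE' hy, sE, if_pos ⟨hE, hE'⟩, if_neg (by norm_num),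
            add_zero]
      · have sE : sgn j E = 1 := if_neg fun h => hE h.1
        rw [if_neg fun h => hE h.1, sE, if_pos (by norm_num)]
        push_cast
        by_cases hE' : j.succ ∈ E
        · rw [addColumn_T_mul_of_notMem hE hE' hy]
          module
        · rw [addColumn_T_mul_of_iff (iff_of_false hE hE') hy,
            sAct_eq_self (iff_of_false hE hE'), Tbar_mul]
          module
    · have sD : sgn j D = 1 := if_neg hD
      rw [if_neg hD, sD, addColumn_Tbar_mul]
      by_cases hE : j.castSucc ∈ E
      · by_cases hE' : j.succ ∈ E
        · have sE : sgn j E = 1 := if_neg fun h => h.2 hE'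
          rw [addColumn_T_mul_of_iff (iff_of_true hE hE') hy, sE, if_neg fun h => h.2 hE',
            sAct_eq_self (iff_of_true hE hE'), Tbar_mul, if_neg (by norm_num), add_zero]
        · have sE : sgn j E = -1 := if_pos ⟨hE, hE'⟩
          rw [addColumn_T_mul_of_mem hE hE' hy, sE, if_pos ⟨hE, hE'⟩, if_pos (by norm_num)]
          push_cast
          module
      · have sE : sgn j E = 1 := if_neg fun h => hE h.1
        rw [if_neg fun h => hE h.1, sE, if_neg (by norm_num), add_zero]
        by_cases hE' : j.succ ∈ E
        · rw [addColumn_T_mul_of_notMem hE hE' hy]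
          module
        · rw [addColumn_T_mul_of_iff (iff_of_false hE hE') hy,
            sAct_eq_self (iff_of_false hE hE'), Tbar_mul]

theorem mem_tensor_one {C : ℕ → Column m} {r : ℕ} (hr : 1 ≤ r) : C 1 ∈ tensor C r := by
  induction r, hr using Nat.le_induction with
  | base => exact List.mem_cons_self
  | succ r _ ih => exact List.mem_cons_of_mem _ ih

/-- If `μ_j > 0`, the first column of `T^0_μ` has `j` in row `j`. The longer column `C` to its left
has there an entry at most `j`, and at least `j` because columns increase strictly; so `j ∈ C`, a
contradiction. Hence `μ_j = 0`, and `μ_{j+1} = 0` by dominance. -/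
theorem apply_eq_of_isSemistandard {μ : Fin (m + 1) → ℕ} (hμ : Antitone μ) {L : List (Column m)}
    (h₁ : IsTensor (L ++ highestTableau μ)) (h₂ : IsSemistandard (L ++ highestTableau μ))
    {C : Column m} (hC : C ∈ L) {j : Fin m} (hj : j.castSucc ∉ C) :
    μ j.castSucc = μ j.succ := by
  rcases Nat.eq_zero_or_pos (μ j.castSucc) with h0 | hpos
  · have := hμ (Fin.castSucc_lt_succ (i := j)).le
    omega
  · exfalso
    obtain ⟨D, hD⟩ : ∃ D : Column m, D = Finset.univ.filter fun i => 0 < μ i := ⟨_, rfl⟩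
    have hDmem : D ∈ highestTableau μ := List.mem_map.2
      ⟨0, List.mem_range.2 (hpos.trans_le (hμ (Fin.zero_le _))), hD.symm⟩
    have hDh : IsHighestColumn D := hD ▸ isHighestColumn_filter hμ 0
    have hjD : (j : ℕ) < D.card := by
      have : j.castSucc ∈ D := by rw [hD]; exact Finset.mem_filter.2 ⟨Finset.mem_univ _, hpos⟩
      exact hDh.mem_iff.1 this
    have hcard : D.card ≤ C.card := (List.pairwise_append.1 h₁.2).2.2 C hC D hDmem
    have hrow := (List.pairwise_append.1 h₂).2.2 C hC D hDmem j (hjD.trans_le hcard) hjD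
    have e : D.orderEmbOfFin rfl ⟨j, hjD⟩ = j.castSucc := by
      have := u_apply_of_lt D (a := j.castSucc) hjD
      rw [u_of_isHighestColumn hDh, Equiv.Perm.one_apply] at this
      exact this.symm
    rw [e] at hrow
    have hge := le_orderEmbOfFin C (hjD.trans_le hcard)
    have : C.orderEmbOfFin rfl ⟨j, hjD.trans_le hcard⟩ = j.castSucc := le_antisymm hrow hge
    exact hj (this ▸ Finset.orderEmbOfFin_mem C rfl _)

end

end HeckeLift

/-! ### The theorem assembled from its three parts. -/

theorem theorem6p3 (m r : ℕ) (C : ℕ → Column m) (hT : IsTensor (tensor C r)) :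
    (¬ IsSemistandard (tensor C r) → Psi (tensor C r) = 0) ∧
    (IsHighestWeight (tensor C r) → Psi (tensor C r) = oneElt (shape (tensor C r))) ∧
    (∀ μ : Fin (m + 1) → ℕ, Antitone μ → 1 ≤ r →
      IsTensor (tensor C r ++ highestTableau μ) →
      IsSemistandard (tensor C r ++ highestTableau μ) →
      ∀ j : Fin m, j.castSucc ∉ C 1 → j.succ ∈ C 1 →
        Psi (tensor C r ++ highestTableau μ) =
          (if j.castSucc ∈ C r ∧ j.succ ∉ C r then
            (TUnit j : H m) * Psi (tensor (Omega j r C) r ++ highestTableau μ)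
          else
            t • (((TUnit j)⁻¹ : (H m)ˣ) : H m) *
              Psi (tensor (Omega j r C) r ++ highestTableau μ)) +
          ∑ k ∈ (Finset.Ico 1 r).filter (fun k => sgn j (C k) * sgn j (C (k + 1)) = -1),
            ((sgn j (C k) : R) * (1 - t)) • Psi (tensor (Omega j k C) r ++ highestTableau μ)) := by
  refine ⟨Psi_eq_zero hT, Psi_of_isHighestWeight, fun μ hμ hr h₁ h₂ j hj hj' => ?_⟩
  have hS : T j * Psi (highestTableau μ) = t • Psi (highestTableau μ) := by
    rw [Psi_of_isHighestWeight (isHighestWeight_highestTableau hμ), shape_highestTableau hμ]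
    exact T_mul_oneElt (apply_eq_of_isSemistandard hμ h₁ h₂ (mem_tensor_one hr) hj)
  rw [Psi_exchange hS hj hj' hr, t_smul_TUnit_inv]
  congr 1
  split_ifs <;> rfl
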